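/- Let $J_1, Y_1$ be the Bessel functions of order one of the first and second kind, $M_1=\sqrt{J_1^2+Y_1^2}$, and let $\theta_1$ be the phase on $(0,\infty)$, i.e. the continuous function with $J_1=M_1\cos\theta_1$, $Y_1=M_1\sin\theta_1$ and $\theta_1(x)\to-\pi/2$ as $x\downarrow 0$ (the continuous branch of $\arctan(Y_1/J_1)$). Then $\theta_1$ exists and is strictly increasing, $J_1$ has a first positive zero $\bar q$, and $\bar q=\theta_1^{-1}(\pi/2)$. Moreover: (a) (Rescaled problem.) For every $q_0>\bar q$ there is exactly one choice of $0<q_-<q_+$, $\lambda\in\mathbb R$ and a monotonically decreasing function $v$ on $[q_-,q_+]$, $C^2$ in $(q_-,q_+)$, with $$q v''+v'+q v=0 \ \text{ on } (q_-,q_+),\quad v(q_-)=1+\lambda,\quad v(q_+)=-1+\lambda,\quad v'(q_-)=v'(q_+)=0,\quad \lambda=\frac{q_+^2+q_-^2-2q_0^2}{q_+^2-q_-^2};$$ and it satisfies $q_-<q_0<q_+$. (b) (Radial problem.) For $\varepsilon,\delta,R_0>0$, an annular profile in $\mathcal B_{R_0}(\delta)$ consists of $0<r_-<r_+\le R_0-\delta$,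 $\lambda\in\mathbb R$ and a monotonically non-increasing function $u$ on $[0,R_0)$ such that $u\equiv1$ on $[0,r_-]$, $-1<u<1$ on $(r_-,r_+)$, $u\equiv-1$ on $[r_+,R_0)$, $u$ is $C^1$ on $(0,R_0)$ and $C^2$ on $(r_-,r_+)$, and $$u+\lambda=-\varepsilon^2\Bigl(u_{rr}+\frac1r u_r\Bigr)\ \text{ on } (r_-,r_+),\qquad u_r(r_-)=u_r(r_+)=0 .$$ For such a profile, and any $r_0$, the mean mass condition $\int_0^{R_0}u(r)\,r\,dr=\frac12(2r_0^2-R_0^2)$ holds if and only if $$\lambda=\frac{r_+^2+r_-^2-2r_0^2}{r_+^2-r_-^2}. \qquad (*)$$ An annular solution with effective radius $r_0$ is an annular profile with $r_-<r_0<r_+$ satisfying $(*)$. There is an absolute constant $C>0$ such that for all $\varepsilon,\delta>0$ and $R_0$ with $C\varepsilon\le R_0-\delta$ (in particular for $0<\varepsilon\ll\delta\ll1$ and $R_0$ of order one), putting $r_0^{\inf}=\varepsilon\bar q$, there is $r_0^{\sup}>r_0^{\inf}$ with $|r_0^{\sup}-(R_0-\delta)|\le C\varepsilon$ such that: for every $r_0\in(r_0^{\inf},r_0^{\sup}]$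 there is exactly one annular solution $(r_-,r_+,\lambda,u)$ in $\mathcal B_{R_0}(\delta)$ with effective radius $r_0$; for $r_0=r_0^{\sup}$ it has $r_+=R_0-\delta$; and for $r_0>r_0^{\sup}$ there is none. -/

import Mathlib

open Real Set Filter Topology

noncomputable section

/-- The Bessel function of the first kind `J_n`, of integer order `n ≥ 0`. -/
def besselJ (n : ℕ) (x : ℝ) : ℝ :=
  ∑' k : ℕ, (-1 : ℝ) ^ k / ((k.factorial : ℝ) * ((n + k).factorial : ℝ)) * (x / 2) ^ (2 * k + n)

/-- The digamma function at positive integers: `digammaSucc m = ψ(m + 1) = H_m - γ`. -/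
def digammaSucc (m : ℕ) : ℝ := ((harmonic m : ℚ) : ℝ) - Real.eulerMascheroniConstant

/-- The Bessel function of the second kind `Y_n`, of integer order `n ≥ 0`, for `x > 0`. -/
def besselY (n : ℕ) (x : ℝ) : ℝ :=
  -(1 / π) * ∑ k ∈ Finset.range n,
      ((n - k - 1).factorial : ℝ) / (k.factorial : ℝ) * ((x / 2) ^ (2 * k) / (x / 2) ^ n)
    + (2 / π) * Real.log (x / 2) * besselJ n x
    - (1 / π) * ∑' k : ℕ, (digammaSucc k + digammaSucc (n + k)) *
        ((-1 : ℝ) ^ k / ((k.factorial : ℝ) * ((n + k).factorial : ℝ)) * (x / 2) ^ (2 * k + n))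

/-- The modulus `M_n = (J_n² + Y_n²)^{1/2}`. -/
def besselModulus (n : ℕ) (x : ℝ) : ℝ := √(besselJ n x ^ 2 + besselY n x ^ 2)

/-- `θ` is, on `(0, ∞)`, the phase function `θ_n = arctan (Y_n / J_n)`: the continuous branch that
tends to `-π/2` at `0`. (These properties determine `θ` on `(0, ∞)`.) -/
structure IsBesselPhase (n : ℕ) (θ : ℝ → ℝ) : Prop where
  continuousOn : ContinuousOn θ (Ioi 0)
  cos_eq : ∀ x : ℝ, 0 < x → besselJ n x = besselModulus n x * Real.cos (θ x)
  sin_eq : ∀ x : ℝ, 0 < x → besselY n x = besselModulus n x * Real.sin (θ x)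
  tendsto_zero : Tendsto θ (𝓝[>] 0) (𝓝 (-(π / 2)))

/-- The rescaled free boundary problem, with unknowns `0 < qm < qp`, `lam` and `v` on `[qm, qp]`:
`v` is a monotone classical solution of `q v'' + v' + q v = 0` in `(qm, qp)` with
`v(qm) = 1 + lam`, `v(qp) = -1 + lam`, and (one-sided) derivatives `v'(qm) = v'(qp) = 0`. -/
structure IsBesselSolution (q0 qm qp lam : ℝ) (v : ℝ → ℝ) : Prop where
  qm_pos : 0 < qm
  qm_lt_qp : qm < qp
  contDiffOn : ContDiffOn ℝ 2 v (Ioo qm qp)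
  ode : ∀ q ∈ Ioo qm qp, q * deriv (deriv v) q + deriv v q + q * v q = 0
  left_value : v qm = 1 + lam
  right_value : v qp = -1 + lam
  left_deriv : HasDerivWithinAt v 0 (Icc qm qp) qm
  right_deriv : HasDerivWithinAt v 0 (Icc qm qp) qp
  antitoneOn : AntitoneOn v (Icc qm qp)
  lam_eq : lam = (qp ^ 2 + qm ^ 2 - 2 * q0 ^ 2) / (qp ^ 2 - qm ^ 2)

/-- A monotone radial annular steady state `u = u(r)`, `0 ≤ r < R0`, in the disc of radius `R0`
with `u = -1` in the bounding annulus of width `δ`: the transition region is `rm < r < rp`, and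
`lam` is the constant in the equation. -/
structure IsAnnularProfile (ε δ R0 rm rp lam : ℝ) (u : ℝ → ℝ) : Prop where
  rm_pos : 0 < rm
  rm_lt_rp : rm < rp
  rp_le : rp ≤ R0 - δ
  eq_one : ∀ r ∈ Icc 0 rm, u r = 1
  mem_Ioo : ∀ r ∈ Ioo rm rp, -1 < u r ∧ u r < 1
  eq_neg_one : ∀ r ∈ Ico rp R0, u r = -1
  antitoneOn : AntitoneOn u (Ico 0 R0)
  contDiffOn_one : ContDiffOn ℝ 1 u (Ioo 0 R0)
  contDiffOn_two : ContDiffOn ℝ 2 u (Ioo rm rp)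
  ode : ∀ r ∈ Ioo rm rp, u r + lam = -ε ^ 2 * (deriv (deriv u) r + 1 / r * deriv u r)
  left_deriv : deriv u rm = 0
  right_deriv : deriv u rp = 0

/-- An annular solution with effective radius `r0`. -/
structure IsAnnularSolution (ε δ R0 r0 rm rp lam : ℝ) (u : ℝ → ℝ) : Prop where
  profile : IsAnnularProfile ε δ R0 rm rp lam u
  rm_lt_r0 : rm < r0
  r0_lt_rp : r0 < rp
  lam_eq : lam = (rp ^ 2 + rm ^ 2 - 2 * r0 ^ 2) / (rp ^ 2 - rm ^ 2)

end

/-! A solution of the order-zero Bessel equation with a critical point `s` is a multiple of one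
cylinder function `v_s`, normalised by `v_s(s) = 1`, and in phase–modulus form `v_s'(q) = -(π s / 2)
M₁(s) M₁(q) sin (θ q - θ s)` (`cosSol_one_eq`). Its critical points are therefore the points where
the phase has moved by a multiple of `π`. Monotonicity allows only one half-turn, so `q₊` is the
conjugate point `T(s)` with `θ (T s) = θ s + π`.

At `T(s)` the solution equals `-β(s)`, where `β(s) = s M₁(s) / (T M₁(T))`. The two boundary values
force `λ = (1 - β) / (1 + β)`, and the formula for `λ` becomes the scalar equation `q₀² = Φ(s)`,
with `Φ = effSq` the mean of `T²` and `s²` with weights `β` and `1`. Existence and uniqueness thus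
amount to `Φ` being continuous and strictly increasing and taking every value `q₀²` with `q₀` above
the first zero.

Write `Φ = s² + (T² - s²) (1 - 1 / (1 + β))`. The energy `v² + v'²` decreases, so `β ≤ 1`, and this
makes `T² - s²` nondecreasing. Moreover `β' = -z(T)`, where `z` is the solution with `z(s) = 0`,
`z'(s) = 1`; a Sturm comparison between orders zero and one gives `z(T) ≤ 0`, so `β` is
nondecreasing (`sinSol_zero_conj_nonpos`). Every term of `Φ` is then monotone. As `s → 0`, `T` tends
to the first zero of `J₁` and `Φ` drops below its square, while `Φ(s) > s²` gives large values.

Scaling by `ε` and extending by `±1` turns this into the radial problem. The constraint `r₊ ≤ R₀ -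
δ` reads `ε T(s) ≤ R₀ - δ`; since `T` and `Φ` both increase, it is an upper bound on `r₀`, attained
when `r₊ = R₀ - δ`. The distance `T(s) - s` is bounded for `s ≥ 1` because `q M₁(q)²` is bounded
(`exists_mul_besselModulus_sq_le`), which gives the `O(ε)` estimate. -/

noncomputable section

/-! ### Entire power series with coefficients `O(1 / k!)` -/

/-- The sum of the power series with coefficients `c`. -/
def powerSum (c : ℕ → ℝ) (y : ℝ) : ℝ := ∑' k, c k * y ^ k

/-- The coefficients of the derivative of a power series. -/
def derivCoeff (c : ℕ → ℝ) (k : ℕ) : ℝ := (k + 1) * c (k + 1)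

theorem derivCoeff_bound {c : ℕ → ℝ} {K : ℝ} (hc : ∀ k, |c k| ≤ K / k.factorial) (k : ℕ) :
    |derivCoeff c k| ≤ K / k.factorial := by
  have h := hc (k + 1)
  have hk : (0 : ℝ) < k + 1 := by positivity
  have hf : (0 : ℝ) < k.factorial := by positivity
  unfold derivCoeff
  rw [abs_mul, abs_of_pos hk]
  calc ((k : ℝ) + 1) * |c (k + 1)| ≤ (k + 1) * (K / (k + 1).factorial) := by gcongr
    _ = K / k.factorial := by
      rw [Nat.factorial_succ]; push_cast; field_simp

theorem summable_powerSum {c : ℕ → ℝ} {K : ℝ} (hc : ∀ k, |c k| ≤ K / k.factorial) (y : ℝ) :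
    Summable fun k => c k * y ^ k := by
  refine Summable.of_norm_bounded ((Real.summable_pow_div_factorial |y|).mul_left K) fun k => ?_
  rw [Real.norm_eq_abs, abs_mul, abs_pow]
  calc |c k| * |y| ^ k ≤ K / k.factorial * |y| ^ k := by gcongr; exact hc k
    _ = K * (|y| ^ k / k.factorial) := by ring

theorem hasDerivAt_powerSum {c : ℕ → ℝ} {K : ℝ} (hc : ∀ k, |c k| ≤ K / k.factorial) (y : ℝ) :
    HasDerivAt (powerSum c) (powerSum (derivCoeff c) y) y := by
  have hK : 0 ≤ K := by simpa using (abs_nonneg _).trans (hc 0)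
  set R : ℝ := |y| + 1
  have hR : 0 ≤ R := by positivity
  -- The term `k = 0` vanishes despite the truncated `k - 1`; shifting the index leaves the
  -- exponential series.
  have hu : Summable fun k : ℕ => K * (k * R ^ (k - 1) / k.factorial) := by
    rw [← summable_nat_add_iff 1]
    refine ((Real.summable_pow_div_factorial R).mul_left K).congr fun k => ?_
    rw [Nat.factorial_succ]
    push_cast
    have : ((k : ℝ) + 1) ≠ 0 := by positivity
    have hf : (k.factorial : ℝ) ≠ 0 := by positivity
    field_simp
  have key := hasDerivAt_tsum_of_isPreconnected (g := fun k y => c k * y ^ k)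
    (g' := fun k y => c k * (k * y ^ (k - 1))) (t := Metric.ball (0 : ℝ) R) (y₀ := 0) (y := y) hu
    Metric.isOpen_ball (convex_ball _ _).isPreconnected
    (fun k x _ => (hasDerivAt_pow k x).const_mul (c k))
    (fun k x hx => by
      have hx' : |x| ≤ R := by
        have : |x| < R := by simpa using hx
        exact this.le
      rw [Real.norm_eq_abs, abs_mul, abs_mul, abs_pow, Nat.abs_cast]
      calc |c k| * (k * |x| ^ (k - 1)) ≤ K / k.factorial * (k * R ^ (k - 1)) := by
            gcongr; exact hc k
        _ = _ := by ring)
    (by simp; positivity) (summable_powerSum hc 0) (by simp [R])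
  have hs : (∑' k : ℕ, c k * (k * y ^ (k - 1))) = powerSum (derivCoeff c) y := by
    have h1 : (∑' k : ℕ, c (k + 1) * (((k + 1 : ℕ) : ℝ) * y ^ k)) = powerSum (derivCoeff c) y :=
      tsum_congr fun k => by unfold derivCoeff; push_cast; ring
    have hsum : Summable fun k : ℕ => c k * (k * y ^ (k - 1)) := by
      rw [← summable_nat_add_iff 1]
      refine (summable_powerSum (derivCoeff_bound hc) y).congr fun k => ?_
      unfold derivCoeff; push_cast; ring
    rw [hsum.tsum_eq_zero_add, ← h1]
    simp
  rw [← hs]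
  exact key

theorem continuous_powerSum {c : ℕ → ℝ} {K : ℝ} (hc : ∀ k, |c k| ≤ K / k.factorial) :
    Continuous (powerSum c) :=
  continuous_iff_continuousAt.2 fun y => (hasDerivAt_powerSum hc y).continuousAt

theorem powerSum_zero (c : ℕ → ℝ) : powerSum c 0 = c 0 := by
  unfold powerSum
  rw [tsum_eq_single 0 (fun k hk => by simp [hk])]
  simp

theorem powerSum_eq_add_mul_shift {c : ℕ → ℝ} {K : ℝ} (hc : ∀ k, |c k| ≤ K / k.factorial) (y : ℝ) :
    powerSum c y = c 0 + y * powerSum (fun k => c (k + 1)) y := by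
  unfold powerSum
  rw [(summable_powerSum hc y).tsum_eq_zero_add, ← tsum_mul_left]
  simp only [pow_zero, mul_one, pow_succ]
  congr 1
  exact tsum_congr fun k => by ring

theorem powerSum_add_mul_derivCoeff {c : ℕ → ℝ} {K : ℝ} (hc : ∀ k, |c k| ≤ K / k.factorial)
    (y : ℝ) :
    powerSum c y + y * powerSum (derivCoeff c) y = powerSum (fun k => (k + 1) * c k) y := by
  have hd := summable_powerSum (derivCoeff_bound hc) y
  have hs : Summable fun k : ℕ => (k : ℝ) * c k * y ^ k := by
    rw [← summable_nat_add_iff 1]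
    refine (hd.mul_left y).congr fun k => ?_
    unfold derivCoeff; push_cast; ring
  have h1 : y * powerSum (derivCoeff c) y = ∑' k : ℕ, (k : ℝ) * c k * y ^ k := by
    rw [hs.tsum_eq_zero_add]
    unfold powerSum
    rw [← tsum_mul_left]
    simp only [Nat.cast_zero, zero_mul, zero_add]
    exact tsum_congr fun k => by unfold derivCoeff; push_cast; ring
  rw [h1]
  unfold powerSum
  rw [← (summable_powerSum hc y).tsum_add hs]
  exact tsum_congr fun k => by ring

/-! ### The series of the Bessel functions of orders zero and one -/

def coeffJ0 (k : ℕ) : ℝ := (-1) ^ k / ((k.factorial : ℝ) * k.factorial)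
def coeffJ1 (k : ℕ) : ℝ := (-1) ^ k / ((k.factorial : ℝ) * (k + 1).factorial)
def coeffY0 (k : ℕ) : ℝ := 2 * digammaSucc k * coeffJ0 k
def coeffY1 (k : ℕ) : ℝ := (digammaSucc k + digammaSucc (k + 1)) * coeffJ1 k

theorem digammaSucc_succ (k : ℕ) : digammaSucc (k + 1) = digammaSucc k + 1 / (k + 1) := by
  unfold digammaSucc
  rw [harmonic_succ]
  push_cast
  ring

theorem abs_digammaSucc_le (k : ℕ) : |digammaSucc k| ≤ k + 1 := by
  induction k with
  | zero =>
    have h1 := Real.one_half_lt_eulerMascheroniConstant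
    have h2 := Real.eulerMascheroniConstant_lt_two_thirds
    unfold digammaSucc
    rw [abs_le]
    constructor <;> simp <;> linarith
  | succ k ih =>
    rw [digammaSucc_succ]
    have h1 : (1 : ℝ) / (k + 1) ≤ 1 := by
      rw [div_le_one (by positivity)]
      have : (0 : ℝ) ≤ k := by positivity
      linarith
    have h2 : (0 : ℝ) ≤ 1 / (k + 1) := by positivity
    have h3 := abs_add_le (digammaSucc k) (1 / (k + 1))
    rw [abs_of_nonneg h2] at h3
    push_cast
    linarith

theorem coeffJ0_bound (k : ℕ) : |coeffJ0 k| ≤ 1 / k.factorial := by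
  unfold coeffJ0
  have h1 : (1 : ℝ) ≤ k.factorial := by exact_mod_cast Nat.one_le_iff_ne_zero.2 k.factorial_ne_zero
  rw [abs_div, abs_pow, abs_neg, abs_one, one_pow, abs_of_pos (by positivity)]
  gcongr
  nlinarith

theorem coeffJ1_bound (k : ℕ) : |coeffJ1 k| ≤ 1 / k.factorial := by
  unfold coeffJ1
  have h1 : (1 : ℝ) ≤ k.factorial := by exact_mod_cast Nat.one_le_iff_ne_zero.2 k.factorial_ne_zero
  have h2 : (1 : ℝ) ≤ (k + 1).factorial := by
    exact_mod_cast Nat.one_le_iff_ne_zero.2 (k + 1).factorial_ne_zero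
  rw [abs_div, abs_pow, abs_neg, abs_one, one_pow, abs_of_pos (by positivity)]
  gcongr
  nlinarith

/-- The Bessel coefficients carry two factorials; one absorbs the at most linear digamma factor and
the other remains. -/
theorem coeffY0_bound (k : ℕ) : |coeffY0 k| ≤ 4 / k.factorial := by
  have hk : k + 1 ≤ 2 * k.factorial := by
    have := Nat.self_le_factorial k
    have := Nat.factorial_pos k
    omega
  have hk' : (k : ℝ) + 1 ≤ 2 * k.factorial := by exact_mod_cast hk
  unfold coeffY0 coeffJ0
  have h1 : (0 : ℝ) < k.factorial := by positivity
  rw [abs_mul, abs_mul, abs_two, abs_div, abs_pow, abs_neg, abs_one, one_pow,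
    abs_of_pos (mul_pos h1 h1), mul_one_div, div_le_div_iff₀ (by positivity) h1]
  have := abs_digammaSucc_le k
  nlinarith [mul_le_mul_of_nonneg_right (this.trans hk') h1.le]

theorem coeffY1_bound (k : ℕ) : |coeffY1 k| ≤ 3 / k.factorial := by
  have hk' : (k : ℝ) + 1 ≤ (k + 1).factorial := by exact_mod_cast Nat.self_le_factorial (k + 1)
  unfold coeffY1 coeffJ1
  have h1 : (0 : ℝ) < k.factorial := by positivity
  have h2 : (0 : ℝ) < (k + 1).factorial := by positivity
  rw [abs_mul, abs_div, abs_pow, abs_neg, abs_one, one_pow,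
    abs_of_pos (mul_pos h1 h2), mul_one_div, div_le_div_iff₀ (by positivity) h1]
  have ha := abs_digammaSucc_le k
  have hb := abs_digammaSucc_le (k + 1)
  push_cast at hb
  have h3 := abs_add_le (digammaSucc k) (digammaSucc (k + 1))
  have h4 : |digammaSucc k + digammaSucc (k + 1)| ≤ 3 * (k + 1).factorial := by
    have : (0 : ℝ) ≤ k := by positivity
    linarith
  nlinarith [mul_le_mul_of_nonneg_right h4 h1.le]

theorem derivCoeff_coeffJ0 (k : ℕ) : derivCoeff coeffJ0 k = -coeffJ1 k := by
  unfold derivCoeff coeffJ0 coeffJ1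
  have h1 : (k.factorial : ℝ) ≠ 0 := by positivity
  rw [Nat.factorial_succ, pow_succ]
  push_cast
  field_simp

theorem succ_mul_coeffJ1 (k : ℕ) : ((k : ℝ) + 1) * coeffJ1 k = coeffJ0 k := by
  unfold coeffJ0 coeffJ1
  have h1 : (k.factorial : ℝ) ≠ 0 := by positivity
  rw [Nat.factorial_succ]
  push_cast
  field_simp

theorem derivCoeff_coeffY0 (k : ℕ) :
    derivCoeff coeffY0 k = -coeffY1 k + coeffJ0 (k + 1) := by
  have h := derivCoeff_coeffJ0 k
  have hk : (k : ℝ) + 1 ≠ 0 := by positivity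
  unfold derivCoeff at h ⊢
  unfold coeffY0 coeffY1
  have h2 : coeffJ1 k = -((k + 1) * coeffJ0 (k + 1)) := by linarith
  rw [h2, digammaSucc_succ]
  field_simp
  ring

theorem succ_mul_coeffY1 (k : ℕ) : ((k : ℝ) + 1) * coeffY1 k = coeffY0 k + coeffJ1 k := by
  have hk : (k : ℝ) + 1 ≠ 0 := by positivity
  unfold coeffY0 coeffY1
  rw [← succ_mul_coeffJ1, digammaSucc_succ]
  field_simp
  ring

theorem powerSum_derivCoeff_coeffJ0 (y : ℝ) :
    powerSum (derivCoeff coeffJ0) y = -powerSum coeffJ1 y := by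
  unfold powerSum
  rw [← tsum_neg]
  exact tsum_congr fun k => by rw [derivCoeff_coeffJ0]; ring

theorem hasDerivAt_mul_powerSum_coeffJ1 (y : ℝ) :
    HasDerivAt (fun y => y * powerSum coeffJ1 y) (powerSum coeffJ0 y) y := by
  have h := (hasDerivAt_id y).mul (hasDerivAt_powerSum coeffJ1_bound y)
  have e := powerSum_add_mul_derivCoeff coeffJ1_bound y
  simp only [succ_mul_coeffJ1] at e
  rw [show powerSum (fun k => coeffJ0 k) y = powerSum coeffJ0 y from rfl] at e
  rw [← e]
  refine h.congr_deriv ?_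
  simp only [id]
  ring

/-- The step `1 / (k + 1)` of the digamma function produces the extra `J₀ - 1`. In `Y₀'` the `J₀`
cancels the derivative of the logarithm and the `-1` becomes the singular term of `Y₁`. -/
theorem mul_powerSum_derivCoeff_coeffY0 (y : ℝ) :
    y * powerSum (derivCoeff coeffY0) y =
      -(y * powerSum coeffY1 y) + powerSum coeffJ0 y - 1 := by
  have e := powerSum_eq_add_mul_shift coeffJ0_bound y
  have hs : Summable fun k => coeffJ0 (k + 1) * y ^ k := by
    refine ((summable_powerSum (derivCoeff_bound coeffY0_bound) y).add
      (summable_powerSum coeffY1_bound y)).congr fun k => ?_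
    rw [derivCoeff_coeffY0]; ring
  have h : powerSum (derivCoeff coeffY0) y =
      -powerSum coeffY1 y + powerSum (fun k => coeffJ0 (k + 1)) y := by
    unfold powerSum
    rw [← tsum_neg, ← (summable_powerSum coeffY1_bound y).neg.tsum_add hs]
    exact tsum_congr fun k => by rw [derivCoeff_coeffY0]; ring
  have h0 : coeffJ0 0 = 1 := by simp [coeffJ0]
  rw [h, e, h0]
  ring

theorem hasDerivAt_mul_powerSum_coeffY1 (y : ℝ) :
    HasDerivAt (fun y => y * powerSum coeffY1 y) (powerSum coeffY0 y + powerSum coeffJ1 y) y := by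
  have h := (hasDerivAt_id y).mul (hasDerivAt_powerSum coeffY1_bound y)
  have e := powerSum_add_mul_derivCoeff coeffY1_bound y
  simp only [succ_mul_coeffY1] at e
  have e2 : powerSum (fun k => coeffY0 k + coeffJ1 k) y
      = powerSum coeffY0 y + powerSum coeffJ1 y := by
    unfold powerSum
    rw [← (summable_powerSum coeffY0_bound y).tsum_add (summable_powerSum coeffJ1_bound y)]
    exact tsum_congr fun k => by ring
  rw [← e2, ← e]
  refine h.congr_deriv ?_
  simp only [id]
  ring

theorem besselJ_zero_eq (x : ℝ) : besselJ 0 x = powerSum coeffJ0 ((x / 2) ^ 2) := by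
  unfold besselJ powerSum coeffJ0
  exact tsum_congr fun k => by rw [← pow_mul]; simp

theorem besselJ_one_eq (x : ℝ) : besselJ 1 x = x / 2 * powerSum coeffJ1 ((x / 2) ^ 2) := by
  unfold besselJ powerSum coeffJ1
  rw [← tsum_mul_left]
  exact tsum_congr fun k => by rw [← pow_mul, add_comm 1 k, pow_succ]; ring

theorem besselY_zero_eq (x : ℝ) : besselY 0 x =
    2 / π * Real.log (x / 2) * besselJ 0 x - 1 / π * powerSum coeffY0 ((x / 2) ^ 2) := by
  unfold besselY powerSum coeffY0 coeffJ0
  simp only [Finset.range_zero, Finset.sum_empty, mul_zero, zero_add, add_zero, ← pow_mul]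
  congr 2
  exact tsum_congr fun k => by ring

theorem besselY_one_eq (x : ℝ) : besselY 1 x =
    -(1 / π) * (1 / (x / 2)) + 2 / π * Real.log (x / 2) * besselJ 1 x
      - 1 / π * (x / 2 * powerSum coeffY1 ((x / 2) ^ 2)) := by
  unfold besselY powerSum coeffY1 coeffJ1
  rw [← tsum_mul_left]
  simp only [Finset.range_one, Finset.sum_singleton, ← pow_mul]
  have e (k : ℕ) : (digammaSucc k + digammaSucc (1 + k)) *
      ((-1 : ℝ) ^ k / ((k.factorial : ℝ) * ((1 + k).factorial : ℝ)) * (x / 2) ^ (2 * k + 1)) =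
      x / 2 * ((digammaSucc k + digammaSucc (k + 1)) *
        ((-1) ^ k / ((k.factorial : ℝ) * (k + 1).factorial)) * (x / 2) ^ (2 * k)) := by
    rw [add_comm 1 k, pow_succ]; ring
  simp only [e]
  simp [tsum_mul_left]

theorem hasDerivAt_half_sq (x : ℝ) : HasDerivAt (fun x : ℝ => (x / 2) ^ 2) (x / 2) x := by
  have h := ((hasDerivAt_id x).div_const 2).pow 2
  refine h.congr_deriv ?_
  simp only [id]
  ring

theorem hasDerivAt_log_half {x : ℝ} (hx : 0 < x) :
    HasDerivAt (fun x : ℝ => Real.log (x / 2)) (1 / x) x := by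
  have h := ((hasDerivAt_id x).div_const 2).log (by simp; exact hx.ne')
  refine h.congr_deriv ?_
  simp only [id]
  field_simp

theorem hasDerivAt_besselJ_zero (x : ℝ) : HasDerivAt (besselJ 0) (-besselJ 1 x) x := by
  have h := (hasDerivAt_powerSum coeffJ0_bound ((x / 2) ^ 2)).comp x (hasDerivAt_half_sq x)
  rw [powerSum_derivCoeff_coeffJ0] at h
  rw [show besselJ 0 = powerSum coeffJ0 ∘ fun x => (x / 2) ^ 2 from funext besselJ_zero_eq]
  refine h.congr_deriv ?_
  rw [besselJ_one_eq]
  ring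

theorem hasDerivAt_mul_besselJ_one (x : ℝ) :
    HasDerivAt (fun x => x * besselJ 1 x) (x * besselJ 0 x) x := by
  have h := ((hasDerivAt_mul_powerSum_coeffJ1 ((x / 2) ^ 2)).comp x
    (hasDerivAt_half_sq x)).const_mul 2
  have e : (fun x => x * besselJ 1 x) =
      fun x => 2 * ((fun y => y * powerSum coeffJ1 y) ∘ fun x => (x / 2) ^ 2) x := by
    funext x
    simp only [Function.comp, besselJ_one_eq]
    ring
  rw [e]
  refine h.congr_deriv ?_
  rw [besselJ_zero_eq]
  ring

theorem hasDerivAt_besselY_zero {x : ℝ} (hx : 0 < x) :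
    HasDerivAt (besselY 0) (-besselY 1 x) x := by
  have h := ((((hasDerivAt_log_half hx).const_mul (2 / π)).mul (hasDerivAt_besselJ_zero x))).sub
    (((hasDerivAt_powerSum coeffY0_bound ((x / 2) ^ 2)).comp x
      (hasDerivAt_half_sq x)).const_mul (1 / π))
  rw [show besselY 0 = _ from funext besselY_zero_eq]
  refine h.congr_deriv ?_
  have e := mul_powerSum_derivCoeff_coeffY0 ((x / 2) ^ 2)
  rw [besselY_one_eq]
  have e0 := besselJ_zero_eq x
  rw [← e0] at e
  have hπ := Real.pi_ne_zero
  have e2 : powerSum (derivCoeff coeffY0) ((x / 2) ^ 2) * (x / 2) =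
      (-((x / 2) ^ 2 * powerSum coeffY1 ((x / 2) ^ 2)) + besselJ 0 x - 1) / (x / 2) := by
    rw [← e]; field_simp
  rw [e2]
  field_simp
  ring

theorem hasDerivAt_mul_besselY_one {x : ℝ} (hx : 0 < x) :
    HasDerivAt (fun x => x * besselY 1 x) (x * besselY 0 x) x := by
  have h := ((((hasDerivAt_log_half hx).const_mul (2 / π)).mul (hasDerivAt_mul_besselJ_one x))).sub
    (((hasDerivAt_mul_powerSum_coeffY1 ((x / 2) ^ 2)).comp x
      (hasDerivAt_half_sq x)).const_mul (2 / π))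
  have h2 := h.add_const (-(2 / π))
  have hπ := Real.pi_ne_zero
  refine (h2.congr_of_eventuallyEq ?_).congr_deriv ?_
  · filter_upwards [lt_mem_nhds hx] with z hz
    simp only [besselY_one_eq, Pi.sub_apply, Pi.mul_apply, Function.comp]
    field_simp
    ring
  · rw [besselY_zero_eq, besselJ_one_eq]
    field_simp
    ring

/-! ### Behaviour at the origin -/

theorem tendsto_half_nhdsGT : Tendsto (fun x : ℝ => x / 2) (𝓝[>] 0) (𝓝[>] 0) := by
  refine tendsto_nhdsWithin_iff.2 ⟨?_, ?_⟩
  · have : Tendsto (fun x : ℝ => x / 2) (𝓝 0) (𝓝 (0 / 2)) := tendsto_id.div_const 2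
    simp only [zero_div] at this
    exact this.mono_left nhdsWithin_le_nhds
  · filter_upwards [self_mem_nhdsWithin] with x hx
    exact half_pos (mem_Ioi.1 hx)

theorem tendsto_powerSum_half_sq {c : ℕ → ℝ} {K : ℝ} (hc : ∀ k, |c k| ≤ K / k.factorial) :
    Tendsto (fun x : ℝ => powerSum c ((x / 2) ^ 2)) (𝓝[>] 0) (𝓝 (c 0)) := by
  have : Continuous fun x : ℝ => powerSum c ((x / 2) ^ 2) :=
    (continuous_powerSum hc).comp (by fun_prop)
  have h := this.tendsto 0
  simp only [zero_div, ne_eq, OfNat.ofNat_ne_zero, not_false_eq_true, zero_pow,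
    powerSum_zero] at h
  exact h.mono_left nhdsWithin_le_nhds

theorem tendsto_id_nhdsGT_zero : Tendsto (fun x : ℝ => x) (𝓝[>] 0) (𝓝 0) :=
  tendsto_id.mono_left nhdsWithin_le_nhds

theorem tendsto_sq_mul_log_half :
    Tendsto (fun x : ℝ => x ^ 2 * Real.log (x / 2)) (𝓝[>] 0) (𝓝 0) := by
  have h := (tendsto_log_mul_rpow_nhdsGT_zero (r := 1) one_pos).comp tendsto_half_nhdsGT
  have h2 := (tendsto_id_nhdsGT_zero.const_mul 2).mul h
  simp only [mul_zero] at h2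
  refine h2.congr fun x => ?_
  simp only [Function.comp, rpow_one]
  ring

theorem tendsto_besselJ_zero : Tendsto (besselJ 0) (𝓝[>] 0) (𝓝 1) := by
  have h := tendsto_powerSum_half_sq coeffJ0_bound
  rw [show coeffJ0 0 = 1 by simp [coeffJ0]] at h
  exact h.congr fun x => (besselJ_zero_eq x).symm

theorem tendsto_mul_besselY_one :
    Tendsto (fun x => x * besselY 1 x) (𝓝[>] 0) (𝓝 (-(2 / π))) := by
  have h1 := (tendsto_sq_mul_log_half.mul (tendsto_powerSum_half_sq coeffJ1_bound)).const_mul (1 / π)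
  have h2 := ((tendsto_id_nhdsGT_zero.pow 2).mul
    (tendsto_powerSum_half_sq coeffY1_bound)).const_mul (1 / (2 * π))
  have h := (h1.sub h2).add_const (-(2 / π))
  simp only [zero_mul, mul_zero, ne_eq, OfNat.ofNat_ne_zero, not_false_eq_true, zero_pow, sub_zero,
    zero_add] at h
  refine h.congr' ?_
  filter_upwards [self_mem_nhdsWithin] with x hx
  have hx : x ≠ 0 := (mem_Ioi.1 hx).ne'
  have hπ := Real.pi_ne_zero
  rw [besselY_one_eq, besselJ_one_eq]
  field_simp
  ring

theorem tendsto_mul_besselJ_one_mul_besselY_zero :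
    Tendsto (fun x => x * besselJ 1 x * besselY 0 x) (𝓝[>] 0) (𝓝 0) := by
  have h0 := tendsto_besselJ_zero
  have hJ := tendsto_powerSum_half_sq coeffJ1_bound
  have h1 := ((tendsto_sq_mul_log_half.mul h0).mul hJ).const_mul (1 / π)
  have h2 := (((tendsto_id_nhdsGT_zero.pow 2).mul
    (tendsto_powerSum_half_sq coeffY0_bound)).mul hJ).const_mul (1 / (2 * π))
  have h := h1.sub h2
  simp only [zero_mul, mul_zero, ne_eq, OfNat.ofNat_ne_zero, not_false_eq_true, zero_pow,
    sub_zero] at h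
  refine h.congr fun x => ?_
  have hπ := Real.pi_ne_zero
  rw [besselY_zero_eq, besselJ_one_eq]
  field_simp

theorem eventually_besselJ_one_pos : ∀ᶠ x in 𝓝[>] (0 : ℝ), 0 < besselJ 1 x := by
  have h := tendsto_powerSum_half_sq coeffJ1_bound
  have h1 : coeffJ1 0 = 1 := by simp [coeffJ1]
  rw [h1] at h
  filter_upwards [h.eventually (lt_mem_nhds zero_lt_one), self_mem_nhdsWithin] with x hx hx0
  rw [besselJ_one_eq]
  exact mul_pos (half_pos hx0) hx

theorem tendsto_besselY_one_div_besselJ_one :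
    Tendsto (fun x => besselY 1 x / besselJ 1 x) (𝓝[>] 0) atBot := by
  have h0 : Tendsto (fun x => x * besselJ 1 x) (𝓝[>] 0) (𝓝[>] 0) := by
    refine tendsto_nhdsWithin_iff.2 ⟨?_, ?_⟩
    · have h := ((hasDerivAt_mul_besselJ_one 0).continuousAt.tendsto).mono_left
        (nhdsWithin_le_nhds (s := Ioi 0))
      simpa using h
    · filter_upwards [self_mem_nhdsWithin, eventually_besselJ_one_pos] with x hx hJ
      exact mul_pos hx hJ
  have h := tendsto_mul_besselY_one.neg_mul_atTop (by simp [Real.pi_pos]) h0.inv_tendsto_nhdsGT_zero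
  refine h.congr' ?_
  filter_upwards [self_mem_nhdsWithin] with x hx
  have hx : x ≠ 0 := (mem_Ioi.1 hx).ne'
  simp only [Pi.inv_apply]
  rw [← div_eq_mul_inv, mul_div_mul_left _ _ hx]

theorem hasDerivAt_besselJ_one {x : ℝ} (hx : 0 < x) :
    HasDerivAt (besselJ 1) (besselJ 0 x - besselJ 1 x / x) x := by
  have h := (hasDerivAt_mul_besselJ_one x).div (hasDerivAt_id x) hx.ne'
  refine (h.congr_of_eventuallyEq ?_).congr_deriv ?_
  · filter_upwards [lt_mem_nhds hx] with z hz
    simp [hz.ne']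
  · simp only [id]
    field_simp

theorem hasDerivAt_besselY_one {x : ℝ} (hx : 0 < x) :
    HasDerivAt (besselY 1) (besselY 0 x - besselY 1 x / x) x := by
  have h := (hasDerivAt_mul_besselY_one hx).div (hasDerivAt_id x) hx.ne'
  refine (h.congr_of_eventuallyEq ?_).congr_deriv ?_
  · filter_upwards [lt_mem_nhds hx] with z hz
    simp [hz.ne']
  · simp only [id]
    field_simp

/-- The Wronskian relation. -/
theorem bessel_wronskian {x : ℝ} (hx : 0 < x) :
    besselJ 1 x * besselY 0 x - besselJ 0 x * besselY 1 x = 2 / (π * x) := by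
  -- The recurrences for `J` and `Y` coincide, so `W` is constant; its value `2 / π` is read off at
  -- the origin.
  set W : ℝ → ℝ := fun x => x * besselJ 1 x * besselY 0 x - besselJ 0 x * (x * besselY 1 x) with hW
  have hd : ∀ x ∈ Ioi (0 : ℝ), HasDerivAt W 0 x := fun x hx => by
    have h := ((hasDerivAt_mul_besselJ_one x).mul (hasDerivAt_besselY_zero hx)).sub
      ((hasDerivAt_besselJ_zero x).mul (hasDerivAt_mul_besselY_one hx))
    refine h.congr_deriv ?_
    ring
  have hc : ∀ y ∈ Ioi (0 : ℝ), W y = W x := fun y hy =>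
    isOpen_Ioi.is_const_of_deriv_eq_zero isPreconnected_Ioi
      (fun z hz => (hd z hz).differentiableAt.differentiableWithinAt)
      (fun z hz => (hd z hz).deriv) hy hx
  have hlim : Tendsto W (𝓝[>] 0) (𝓝 (0 - 1 * (-(2 / π)))) :=
    tendsto_mul_besselJ_one_mul_besselY_zero.sub (tendsto_besselJ_zero.mul tendsto_mul_besselY_one)
  have hlim2 : Tendsto W (𝓝[>] 0) (𝓝 (W x)) := by
    refine tendsto_const_nhds.congr' ?_
    filter_upwards [self_mem_nhdsWithin] with y hy
    exact (hc y hy).symm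
  have h := tendsto_nhds_unique hlim2 hlim
  simp only [hW] at h
  have hπ := Real.pi_ne_zero
  field_simp at h ⊢
  linarith

/-! ### The phase function of order one -/

theorem besselModulus_sq (n : ℕ) (x : ℝ) :
    besselModulus n x ^ 2 = besselJ n x ^ 2 + besselY n x ^ 2 :=
  Real.sq_sqrt (by positivity)

theorem besselModulus_one_pos {x : ℝ} (hx : 0 < x) : 0 < besselModulus 1 x := by
  refine Real.sqrt_pos.2 ?_
  by_contra h
  have h1 : besselJ 1 x = 0 := by nlinarith [sq_nonneg (besselJ 1 x), sq_nonneg (besselY 1 x)]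
  have h2 : besselY 1 x = 0 := by nlinarith [sq_nonneg (besselJ 1 x), sq_nonneg (besselY 1 x)]
  have hW := bessel_wronskian hx
  rw [h1, h2] at hW
  have : 0 < 2 / (π * x) := by positivity
  linarith

/-- The derivative of the phase function of order one. -/
def phaseDeriv (x : ℝ) : ℝ := 2 / (π * x * besselModulus 1 x ^ 2)

theorem phaseDeriv_pos {x : ℝ} (hx : 0 < x) : 0 < phaseDeriv x := by
  have := besselModulus_one_pos hx
  unfold phaseDeriv
  positivity

theorem continuousAt_phaseDeriv {x : ℝ} (hx : 0 < x) : ContinuousAt phaseDeriv x := by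
  unfold phaseDeriv
  simp only [besselModulus_sq]
  have h : π * x * (besselJ 1 x ^ 2 + besselY 1 x ^ 2) ≠ 0 := by
    rw [← besselModulus_sq]
    have := besselModulus_one_pos hx
    positivity
  exact continuousAt_const.div ((continuousAt_const.mul continuousAt_id).mul
    (((hasDerivAt_besselJ_one hx).continuousAt.pow 2).add
      ((hasDerivAt_besselY_one hx).continuousAt.pow 2))) h

theorem hasDerivAt_besselModulus_one {x : ℝ} (hx : 0 < x) :
    HasDerivAt (besselModulus 1) ((besselJ 0 x * besselJ 1 x + besselY 0 x * besselY 1 x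
      - besselModulus 1 x ^ 2 / x) / besselModulus 1 x) x := by
  have hM := besselModulus_one_pos hx
  have hM2 : besselJ 1 x ^ 2 + besselY 1 x ^ 2 ≠ 0 := by
    rw [← besselModulus_sq]; positivity
  have h := (((hasDerivAt_besselJ_one hx).pow 2).add ((hasDerivAt_besselY_one hx).pow 2)).sqrt hM2
  refine h.congr_deriv ?_
  change _ / (2 * besselModulus 1 x) = _
  rw [besselModulus_sq]
  push_cast
  field_simp
  ring

/-- The unit vector field `(J₁, Y₁) / M₁` rotates at the rate `phaseDeriv`. -/
theorem hasDerivAt_besselJ_one_div_modulus {x : ℝ} (hx : 0 < x) :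
    HasDerivAt (fun x => besselJ 1 x / besselModulus 1 x)
      (-(phaseDeriv x * (besselY 1 x / besselModulus 1 x))) x := by
  have hM := besselModulus_one_pos hx
  have h := (hasDerivAt_besselJ_one hx).div (hasDerivAt_besselModulus_one hx) hM.ne'
  refine h.congr_deriv ?_
  have hW := bessel_wronskian hx
  have e : phaseDeriv x = (besselJ 1 x * besselY 0 x - besselJ 0 x * besselY 1 x) /
      besselModulus 1 x ^ 2 := by
    rw [hW]; unfold phaseDeriv; field_simp
  have hs := besselModulus_sq 1 x
  rw [e]
  field_simp
  rw [hs]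
  ring

theorem hasDerivAt_besselY_one_div_modulus {x : ℝ} (hx : 0 < x) :
    HasDerivAt (fun x => besselY 1 x / besselModulus 1 x)
      (phaseDeriv x * (besselJ 1 x / besselModulus 1 x)) x := by
  have hM := besselModulus_one_pos hx
  have h := (hasDerivAt_besselY_one hx).div (hasDerivAt_besselModulus_one hx) hM.ne'
  refine h.congr_deriv ?_
  have hW := bessel_wronskian hx
  have e : phaseDeriv x = (besselJ 1 x * besselY 0 x - besselJ 0 x * besselY 1 x) /
      besselModulus 1 x ^ 2 := by
    rw [hW]; unfold phaseDeriv; field_simp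
  have hs := besselModulus_sq 1 x
  rw [e]
  field_simp
  rw [hs]
  ring

/-- The phase function is an antiderivative of `phaseDeriv`. -/
structure IsPhase (θ : ℝ → ℝ) : Prop extends IsBesselPhase 1 θ where
  hasDerivAt : ∀ x : ℝ, 0 < x → HasDerivAt θ (phaseDeriv x) x

/-- The phase is built by integrating its known derivative, which avoids gluing branches of the
arctangent. The base point lies where `J₁ > 0` all the way down to `0`, so that near the origin `θ`
is the principal arctangent and its limit can be read off. -/
theorem exists_isPhase : ∃ θ : ℝ → ℝ, IsPhase θ := by
  obtain ⟨x₁, hx₁, hJ⟩ : ∃ x₁ : ℝ, 0 < x₁ ∧ ∀ x ∈ Ioc 0 x₁, 0 < besselJ 1 x := by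
    obtain ⟨u, hu, hs⟩ := mem_nhdsGT_iff_exists_Ioc_subset.1 eventually_besselJ_one_pos
    exact ⟨u, hu, fun x hx => hs hx⟩
  set θ : ℝ → ℝ := fun x =>
    arctan (besselY 1 x₁ / besselJ 1 x₁) + ∫ t in x₁..x, phaseDeriv t with hθ
  have hd : ∀ x : ℝ, 0 < x → HasDerivAt θ (phaseDeriv x) x := fun x hx => by
    have hc : ContinuousOn phaseDeriv (Ioi 0) := fun y hy =>
      (continuousAt_phaseDeriv hy).continuousWithinAt
    have hi : IntervalIntegrable phaseDeriv MeasureTheory.volume x₁ x :=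
      (hc.mono fun y hy => (lt_min hx₁ hx).trans_le hy.1).intervalIntegrable
    exact (intervalIntegral.integral_hasDerivAt_right hi
      (hc.stronglyMeasurableAtFilter isOpen_Ioi x hx) (continuousAt_phaseDeriv hx)).const_add _
  have harc : ∀ x ∈ Ioc 0 x₁, θ x = arctan (besselY 1 x / besselJ 1 x) := by
    intro x hx
    have hd2 : ∀ y ∈ Icc x x₁, HasDerivAt (fun z => θ z - arctan (besselY 1 z / besselJ 1 z)) 0 y := by
      intro y hy
      have hy0 : 0 < y := hx.1.trans_le hy.1
      have hJy := hJ y ⟨hy0, hy.2⟩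
      have h := (hd y hy0).sub
        ((hasDerivAt_besselY_one hy0).div (hasDerivAt_besselJ_one hy0) hJy.ne').arctan
      refine h.congr_deriv ?_
      have hW := bessel_wronskian hy0
      have hM := besselModulus_one_pos hy0
      have e : phaseDeriv y = (besselJ 1 y * besselY 0 y - besselJ 0 y * besselY 1 y) /
          besselModulus 1 y ^ 2 := by
        rw [hW]; unfold phaseDeriv; field_simp
      have hne : besselJ 1 y ^ 2 + besselY 1 y ^ 2 ≠ 0 := by positivity
      rw [e, besselModulus_sq]
      simp only [Pi.div_apply]
      field_simp
      ring
    have h := constant_of_has_deriv_right_zero (f := fun z => θ z - arctan (besselY 1 z / besselJ 1 z))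
      (a := x) (b := x₁)
      (fun y hy => (hd2 y hy).continuousAt.continuousWithinAt)
      (fun y hy => (hd2 y (Ico_subset_Icc_self hy)).hasDerivWithinAt) x₁ (right_mem_Icc.2 hx.2)
    have h1 : θ x₁ = arctan (besselY 1 x₁ / besselJ 1 x₁) := by simp [hθ]
    simp only [h1, sub_self] at h
    linarith
  have hunit : ∀ x : ℝ, 0 < x → besselJ 1 x / besselModulus 1 x = Real.cos (θ x) ∧
      besselY 1 x / besselModulus 1 x = Real.sin (θ x) := by
    have hnorm : ∀ x : ℝ, 0 < x →
        (besselJ 1 x / besselModulus 1 x) ^ 2 + (besselY 1 x / besselModulus 1 x) ^ 2 = 1 := by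
      intro x hx
      have hM := besselModulus_one_pos hx
      rw [div_pow, div_pow, ← add_div, ← besselModulus_sq, div_self (by positivity)]
    -- The inner product of two unit vectors rotating at the same rate is constant. It is `1` at
    -- `x₁`, so the vectors agree everywhere.
    set f : ℝ → ℝ := fun x => besselJ 1 x / besselModulus 1 x * Real.cos (θ x) +
      besselY 1 x / besselModulus 1 x * Real.sin (θ x) with hf
    have hfd : ∀ x ∈ Ioi (0 : ℝ), HasDerivAt f 0 x := fun x hx => by
      have h := ((hasDerivAt_besselJ_one_div_modulus hx).mul (hd x hx).cos).add
        ((hasDerivAt_besselY_one_div_modulus hx).mul (hd x hx).sin)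
      refine h.congr_deriv ?_
      ring
    have hf1 : f x₁ = 1 := by
      have hM := besselModulus_one_pos hx₁
      have hJ1 := hJ x₁ ⟨hx₁, le_rfl⟩
      have hsq : √(1 + (besselY 1 x₁ / besselJ 1 x₁) ^ 2) = besselModulus 1 x₁ / besselJ 1 x₁ := by
        rw [Real.sqrt_eq_iff_mul_self_eq (by positivity) (by positivity)]
        field_simp
        exact (besselModulus_sq 1 x₁).symm
      simp only [hf]
      rw [harc x₁ ⟨hx₁, le_rfl⟩, Real.cos_arctan, Real.sin_arctan, hsq]
      have := besselModulus_sq 1 x₁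
      field_simp
      linarith
    intro x hx
    have h : f x = f x₁ := isOpen_Ioi.is_const_of_deriv_eq_zero isPreconnected_Ioi
      (fun z hz => (hfd z hz).differentiableAt.differentiableWithinAt)
      (fun z hz => (hfd z hz).deriv) hx hx₁
    rw [hf1] at h
    simp only [hf] at h
    have h1 := hnorm x hx
    have h2 := Real.cos_sq_add_sin_sq (θ x)
    have h3 : (besselJ 1 x / besselModulus 1 x - Real.cos (θ x)) ^ 2 +
        (besselY 1 x / besselModulus 1 x - Real.sin (θ x)) ^ 2 = 0 := by nlinarith
    constructor
    · nlinarith [sq_nonneg (besselJ 1 x / besselModulus 1 x - Real.cos (θ x)),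
        sq_nonneg (besselY 1 x / besselModulus 1 x - Real.sin (θ x))]
    · nlinarith [sq_nonneg (besselJ 1 x / besselModulus 1 x - Real.cos (θ x)),
        sq_nonneg (besselY 1 x / besselModulus 1 x - Real.sin (θ x))]
  refine ⟨θ, ⟨fun x hx => (hd x hx).continuousAt.continuousWithinAt, fun x hx => ?_,
    fun x hx => ?_, ?_⟩, hd⟩
  · have hM := besselModulus_one_pos hx
    rw [← (hunit x hx).1]; field_simp
  · have hM := besselModulus_one_pos hx
    rw [← (hunit x hx).2]; field_simp
  · have h := (tendsto_arctan_atBot.comp tendsto_besselY_one_div_besselJ_one).mono_right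
      nhdsWithin_le_nhds
    refine h.congr' ?_
    filter_upwards [Ioc_mem_nhdsGT hx₁] with x hx
    exact (harc x hx).symm

/-- `q M₁(q)²` is bounded on `[1, ∞)`. -/
theorem exists_mul_besselModulus_sq_le :
    ∃ K : ℝ, 0 < K ∧ ∀ q : ℝ, 1 ≤ q → q * besselModulus 1 q ^ 2 ≤ K := by
  set S : ℝ → ℝ := fun q => besselJ 0 q ^ 2 + besselY 0 q ^ 2 + (besselJ 1 q ^ 2 + besselY 1 q ^ 2)
    with hS
  set g : ℝ → ℝ := fun q => besselJ 0 q * besselJ 1 q + besselY 0 q * besselY 1 q with hg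
  have hgS : ∀ q, |g q| ≤ S q / 2 := fun q => by
    simp only [hg, hS]
    rw [abs_le]
    constructor
    · nlinarith [sq_nonneg (besselJ 0 q + besselJ 1 q), sq_nonneg (besselY 0 q + besselY 1 q)]
    · nlinarith [sq_nonneg (besselJ 0 q - besselJ 1 q), sq_nonneg (besselY 0 q - besselY 1 q)]
  -- The recurrences give `(q S - g)' = g / q`, and `|g| ≤ S / 2` makes `q S - g` comparable to `q
  -- S` on `[1, ∞)`. The factor `exp (1 / q)`, bounded there, absorbs the remaining growth and makes
  -- `E` nonincreasing.
  set E : ℝ → ℝ := fun q => (q * S q - g q) * Real.exp (1 / q) with hE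
  have hd : ∀ q : ℝ, 0 < q → HasDerivAt E
      ((g q / q) * Real.exp (1 / q) - (q * S q - g q) * (Real.exp (1 / q) / q ^ 2)) q := by
    intro q hq
    have hJ0 := hasDerivAt_besselJ_zero q
    have hY0 := hasDerivAt_besselY_zero hq
    have hJ1 := hasDerivAt_besselJ_one hq
    have hY1 := hasDerivAt_besselY_one hq
    have hSd := ((hJ0.pow 2).add (hY0.pow 2)).add ((hJ1.pow 2).add (hY1.pow 2))
    have hgd := (hJ0.mul hJ1).add (hY0.mul hY1)
    have hexp : HasDerivAt (fun q : ℝ => Real.exp (1 / q)) (Real.exp (1 / q) * -(1 / q ^ 2)) q := by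
      have h := (hasDerivAt_inv hq.ne').exp
      simp only [one_div]
      refine h.congr_deriv ?_
      ring
    have h := (((hasDerivAt_id q).mul hSd).sub hgd).mul hexp
    refine h.congr_deriv ?_
    simp only [hS, hg, id, Pi.add_apply, Pi.mul_apply, Pi.pow_apply, Pi.sub_apply]
    push_cast
    field_simp
    ring
  have hanti : AntitoneOn E (Ici 1) := by
    refine antitoneOn_of_deriv_nonpos (convex_Ici 1)
      (fun q hq => (hd q (zero_lt_one.trans_le hq)).continuousAt.continuousWithinAt)
      (fun q hq => (hd q (zero_lt_one.trans (by simpa using hq))).differentiableAt.differentiableWithinAt)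
      (fun q hq => ?_)
    have hq1 : 1 < q := by simpa using hq
    have hq0 : 0 < q := zero_lt_one.trans hq1
    rw [(hd q hq0).deriv]
    have h1 := abs_le.1 (hgS q)
    have hS0 : 0 ≤ S q := by simp only [hS]; positivity
    have h2 : (g q / q) * Real.exp (1 / q) - (q * S q - g q) * (Real.exp (1 / q) / q ^ 2) =
        -(Real.exp (1 / q) / q ^ 2 * (q * S q - g q - q * g q)) := by
      field_simp; ring
    rw [h2, Left.neg_nonpos_iff]
    refine mul_nonneg (by positivity) ?_
    nlinarith [mul_le_mul_of_nonneg_left h1.2 hq0.le, mul_nonneg hS0 (sub_nonneg.2 hq1.le)]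
  have hE1 : 0 < E 1 := by
    have h1 := abs_le.1 (hgS 1)
    have hM := besselModulus_one_pos one_pos
    have hS1 : 0 < S 1 := by
      have h3 : 0 < besselJ 1 1 ^ 2 + besselY 1 1 ^ 2 := by rw [← besselModulus_sq]; positivity
      simp only [hS]
      positivity
    refine mul_pos ?_ (Real.exp_pos _)
    linarith
  refine ⟨2 * E 1, by positivity, fun q hq => ?_⟩
  have h := hanti self_mem_Ici hq hq
  have hq0 : 0 < q := zero_lt_one.trans_le hq
  have h1 := abs_le.1 (hgS q)
  have hS0 : 0 ≤ S q := by simp only [hS]; positivity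
  have hexp : 1 ≤ Real.exp (1 / q) := Real.one_le_exp (by positivity)
  have h3 : q * S q / 2 ≤ q * S q - g q := by nlinarith
  have h4 : q * S q / 2 ≤ E q := by
    refine h3.trans ?_
    have : 0 ≤ q * S q - g q := by
      refine le_trans ?_ h3
      positivity
    simp only [hE]
    nlinarith
  have h5 : besselModulus 1 q ^ 2 ≤ S q := by
    rw [besselModulus_sq]
    simp only [hS]
    nlinarith [sq_nonneg (besselJ 0 q), sq_nonneg (besselY 0 q)]
  nlinarith [mul_le_mul_of_nonneg_left h5 hq0.le]

/-! ### Growth and range of the phase -/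

namespace IsPhase

variable {θ : ℝ → ℝ}

theorem strictMonoOn (h : IsPhase θ) : StrictMonoOn θ (Ioi 0) := by
  refine strictMonoOn_of_deriv_pos (convex_Ioi 0) h.continuousOn fun x hx => ?_
  rw [interior_Ioi] at hx
  rw [(h.hasDerivAt x hx).deriv]
  exact phaseDeriv_pos hx

theorem exists_add_pi_le (h : IsPhase θ) :
    ∃ L : ℝ, 0 < L ∧ ∀ x : ℝ, 1 ≤ x → θ x + π ≤ θ (x + L) := by
  obtain ⟨K, hK, hb⟩ := exists_mul_besselModulus_sq_le
  -- On `[1, ∞)` the phase has slope at least `2 / (π K)`, so it gains `π` over this length.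
  refine ⟨π ^ 2 * K / 2, by positivity, fun x hx => ?_⟩
  have hsub : ∀ y ∈ Icc x (x + π ^ 2 * K / 2), 1 ≤ y := fun y hy => hx.trans hy.1
  have hle : x ≤ x + π ^ 2 * K / 2 := by
    have : 0 ≤ π ^ 2 * K / 2 := by positivity
    linarith
  have hd : ∀ y, 1 ≤ y → HasDerivAt θ (phaseDeriv y) y := fun y hy =>
    h.hasDerivAt y (zero_lt_one.trans_le hy)
  have key := (convex_Icc x (x + π ^ 2 * K / 2)).mul_sub_le_image_sub_of_le_deriv (f := θ)
    (C := 2 / (π * K))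
    (fun y hy => (hd y (hsub y hy)).continuousAt.continuousWithinAt)
    (fun y hy => (hd y (hsub y (interior_subset hy))).differentiableAt.differentiableWithinAt)
    (fun y hy => by
      have hy1 := hsub y (interior_subset hy)
      have hy0 : 0 < y := zero_lt_one.trans_le hy1
      have hM := besselModulus_one_pos hy0
      rw [(hd y hy1).deriv]
      unfold phaseDeriv
      rw [mul_assoc]
      have := hb y hy1
      gcongr)
    x (left_mem_Icc.2 hle) _ (right_mem_Icc.2 hle) hle
  have e : 2 / (π * K) * (x + π ^ 2 * K / 2 - x) = π := by
    have := Real.pi_pos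
    field_simp
    ring
  linarith

theorem neg_pi_div_two_lt (h : IsPhase θ) {x : ℝ} (hx : 0 < x) : -(π / 2) < θ x := by
  have h1 : -(π / 2) ≤ θ (x / 2) := by
    refine le_of_tendsto h.tendsto_zero ?_
    filter_upwards [Ioc_mem_nhdsGT (half_pos hx)] with y hy
    exact h.strictMonoOn.monotoneOn hy.1 (half_pos hx) hy.2
  exact h1.trans_lt (h.strictMonoOn (half_pos hx) hx (half_lt_self hx))

theorem exists_eq (h : IsPhase θ) {φ : ℝ} (hφ : -(π / 2) < φ) : ∃ x, 0 < x ∧ θ x = φ := by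
  obtain ⟨L, hL, hadd⟩ := h.exists_add_pi_le
  have hn : ∀ n : ℕ, θ 1 + n * π ≤ θ (1 + n * L) := by
    intro n
    induction n with
    | zero => simp
    | succ n ih =>
      have h1 := hadd (1 + n * L) (by have : 0 ≤ n * L := by positivity
                                      linarith)
      push_cast
      rw [show 1 + ((n : ℝ) + 1) * L = 1 + n * L + L by ring]
      linarith
  obtain ⟨a, ha, hφa⟩ : ∃ a, 0 < a ∧ θ a < φ := by
    have := (h.tendsto_zero.eventually (gt_mem_nhds hφ)).and self_mem_nhdsWithin
    obtain ⟨a, ha1, ha2⟩ := this.exists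
    exact ⟨a, ha2, ha1⟩
  obtain ⟨n, hn2⟩ := exists_nat_ge ((φ - θ 1) / π)
  have hb : φ ≤ θ (1 + n * L) := by
    rw [div_le_iff₀ Real.pi_pos] at hn2
    linarith [hn n]
  have hb0 : 0 < 1 + n * L := by positivity
  have hab : a ≤ 1 + n * L := by
    by_contra hlt
    have := h.strictMonoOn hb0 ha (not_le.1 hlt)
    linarith
  obtain ⟨x, hx, hxe⟩ := intermediate_value_Icc hab
    (h.continuousOn.mono fun y hy => ha.trans_le hy.1) ⟨hφa.le, hb⟩
  exact ⟨x, ha.trans_le hx.1, hxe⟩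

end IsPhase

/-! ### Cylinder functions of orders zero and one -/

/-- The cylinder function `a J_n + b Y_n`. -/
def cylinder (n : ℕ) (a b q : ℝ) : ℝ := a * besselJ n q + b * besselY n q

theorem hasDerivAt_cylinder_zero (a b : ℝ) {q : ℝ} (hq : 0 < q) :
    HasDerivAt (cylinder 0 a b) (-cylinder 1 a b q) q := by
  have h := ((hasDerivAt_besselJ_zero q).const_mul a).add ((hasDerivAt_besselY_zero hq).const_mul b)
  refine h.congr_deriv ?_
  unfold cylinder
  ring

theorem hasDerivAt_cylinder_one (a b : ℝ) {q : ℝ} (hq : 0 < q) :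
    HasDerivAt (cylinder 1 a b) (cylinder 0 a b q - cylinder 1 a b q / q) q := by
  have h := ((hasDerivAt_besselJ_one hq).const_mul a).add ((hasDerivAt_besselY_one hq).const_mul b)
  refine h.congr_deriv ?_
  unfold cylinder
  ring

/-- `cosSol 0 s` solves Bessel's equation of order zero with `v(s) = 1`, `v'(s) = 0`;
`cosSol 1 s = -(cosSol 0 s)'`. -/
def cosSol (n : ℕ) (s : ℝ) : ℝ → ℝ :=
  cylinder n (-(π * s / 2 * besselY 1 s)) (π * s / 2 * besselJ 1 s)

/-- `sinSol 0 s` solves Bessel's equation of order zero with `z(s) = 0`, `z'(s) = 1`;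
`sinSol 1 s = -(sinSol 0 s)'`. -/
def sinSol (n : ℕ) (s : ℝ) : ℝ → ℝ :=
  cylinder n (-(π * s / 2 * besselY 0 s)) (π * s / 2 * besselJ 0 s)

theorem hasDerivAt_cosSol_zero (s : ℝ) {q : ℝ} (hq : 0 < q) :
    HasDerivAt (cosSol 0 s) (-cosSol 1 s q) q := hasDerivAt_cylinder_zero _ _ hq

theorem hasDerivAt_cosSol_one (s : ℝ) {q : ℝ} (hq : 0 < q) :
    HasDerivAt (cosSol 1 s) (cosSol 0 s q - cosSol 1 s q / q) q := hasDerivAt_cylinder_one _ _ hq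

theorem hasDerivAt_sinSol_zero (s : ℝ) {q : ℝ} (hq : 0 < q) :
    HasDerivAt (sinSol 0 s) (-sinSol 1 s q) q := hasDerivAt_cylinder_zero _ _ hq

theorem hasDerivAt_sinSol_one (s : ℝ) {q : ℝ} (hq : 0 < q) :
    HasDerivAt (sinSol 1 s) (sinSol 0 s q - sinSol 1 s q / q) q := hasDerivAt_cylinder_one _ _ hq

theorem cosSol_zero_self {s : ℝ} (hs : 0 < s) : cosSol 0 s s = 1 := by
  have hW := bessel_wronskian hs
  have e : cosSol 0 s s = π * s / 2 *
      (besselJ 1 s * besselY 0 s - besselJ 0 s * besselY 1 s) := by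
    unfold cosSol cylinder; ring
  rw [e, hW]
  field_simp

theorem cosSol_one_self (s : ℝ) : cosSol 1 s s = 0 := by
  unfold cosSol cylinder; ring

theorem sinSol_zero_self (s : ℝ) : sinSol 0 s s = 0 := by
  unfold sinSol cylinder; ring

theorem cosSol_sinSol_wronskian {s q : ℝ} (hs : 0 < s) (hq : 0 < q) :
    q * (sinSol 0 s q * cosSol 1 s q - sinSol 1 s q * cosSol 0 s q) = s := by
  have hWs := bessel_wronskian hs
  have hWq := bessel_wronskian hq
  have e : sinSol 0 s q * cosSol 1 s q - sinSol 1 s q * cosSol 0 s q = (π * s / 2) ^ 2 *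
      ((besselJ 1 s * besselY 0 s - besselJ 0 s * besselY 1 s) *
        (besselJ 1 q * besselY 0 q - besselJ 0 q * besselY 1 q)) := by
    unfold cosSol sinSol cylinder; ring
  rw [e, hWs, hWq]
  field_simp

namespace IsPhase

variable {θ : ℝ → ℝ}

theorem cosSol_one_eq (h : IsPhase θ) {s q : ℝ} (hs : 0 < s) (hq : 0 < q) :
    cosSol 1 s q =
      π * s / 2 * (besselModulus 1 s * besselModulus 1 q * Real.sin (θ q - θ s)) := by
  unfold cosSol cylinder
  rw [Real.sin_sub, h.cos_eq s hs, h.sin_eq s hs, h.cos_eq q hq, h.sin_eq q hq]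
  ring

end IsPhase

/-! ### Conjugate points and the effective radius as a function of `q₋` -/

/-- The inverse of the phase function. -/
def invPhase (θ : ℝ → ℝ) : ℝ → ℝ := Function.invFunOn θ (Ioi 0)

/-- The point at which the phase is larger by `π`. -/
def conjPoint (θ : ℝ → ℝ) (s : ℝ) : ℝ := invPhase θ (θ s + π)

/-- `q M₁(q)`. -/
def amplitude (q : ℝ) : ℝ := q * besselModulus 1 q

/-- The ratio of the amplitudes of the solution `cosSol 0 s` at its critical points
`conjPoint θ s` and `s`. -/
def amplitudeRatio (θ : ℝ → ℝ) (s : ℝ) : ℝ := amplitude s / amplitude (conjPoint θ s)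

/-- The square of the effective radius `q₀` as a function of `q₋`. -/
def effSq (θ : ℝ → ℝ) (s : ℝ) : ℝ :=
  (amplitudeRatio θ s * conjPoint θ s ^ 2 + s ^ 2) / (1 + amplitudeRatio θ s)

theorem amplitude_pos {q : ℝ} (hq : 0 < q) : 0 < amplitude q :=
  mul_pos hq (besselModulus_one_pos hq)

theorem hasDerivAt_amplitude {q : ℝ} (hq : 0 < q) :
    HasDerivAt amplitude (q * (besselJ 0 q * besselJ 1 q + besselY 0 q * besselY 1 q)
      / besselModulus 1 q) q := by
  have h := (hasDerivAt_id q).mul (hasDerivAt_besselModulus_one hq)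
  refine h.congr_deriv ?_
  have := besselModulus_one_pos hq
  simp only [id]
  field_simp
  ring

namespace IsPhase

variable {θ : ℝ → ℝ} {s : ℝ}

theorem invPhase_phase (h : IsPhase θ) {x : ℝ} (hx : 0 < x) : invPhase θ (θ x) = x :=
  h.strictMonoOn.injOn.leftInvOn_invFunOn hx

theorem hasDerivAt_invPhase (h : IsPhase θ) {x : ℝ} (hx : 0 < x) :
    HasDerivAt (invPhase θ) (phaseDeriv x)⁻¹ (θ x) := by
  have hs : HasStrictDerivAt θ (phaseDeriv x) x :=
    hasStrictDerivAt_of_hasDerivAt_of_continuousAt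
      (by filter_upwards [lt_mem_nhds hx] with y hy using h.hasDerivAt y hy)
      (continuousAt_phaseDeriv hx)
  exact (hs.to_local_left_inverse (phaseDeriv_pos hx).ne'
    (by filter_upwards [lt_mem_nhds hx] with y hy using h.invPhase_phase hy)).hasDerivAt

theorem conj_spec (h : IsPhase θ) (hs : 0 < s) : 0 < conjPoint θ s ∧ θ (conjPoint θ s) = θ s + π := by
  obtain ⟨x, hx, hxe⟩ := h.exists_eq (φ := θ s + π) (by
    have := h.neg_pi_div_two_lt hs
    have := Real.pi_pos
    linarith)
  unfold conjPoint
  rw [← hxe, h.invPhase_phase hx]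
  exact ⟨hx, rfl⟩

theorem conj_pos (h : IsPhase θ) (hs : 0 < s) : 0 < conjPoint θ s := (h.conj_spec hs).1

theorem phase_conj (h : IsPhase θ) (hs : 0 < s) : θ (conjPoint θ s) = θ s + π := (h.conj_spec hs).2

theorem eq_conj (h : IsPhase θ) {t : ℝ} (ht : 0 < t) (he : θ t = θ s + π) :
    t = conjPoint θ s := by
  unfold conjPoint
  rw [← he, h.invPhase_phase ht]

theorem lt_conj (h : IsPhase θ) (hs : 0 < s) : s < conjPoint θ s := by
  refine (h.strictMonoOn.lt_iff_lt hs (h.conj_pos hs)).1 ?_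
  rw [h.phase_conj hs]
  linarith [Real.pi_pos]

theorem conj_strictMonoOn (h : IsPhase θ) : StrictMonoOn (conjPoint θ) (Ioi 0) := fun s hs t ht hst => by
  refine (h.strictMonoOn.lt_iff_lt (h.conj_pos hs) (h.conj_pos ht)).1 ?_
  rw [h.phase_conj hs, h.phase_conj ht]
  linarith [h.strictMonoOn hs ht hst]

/-- Differentiating `θ (T s) = θ s + π` gives `T' = θ'(s) / θ'(T)`, rewritten through the ratio of
amplitudes. -/
theorem hasDerivAt_conj (h : IsPhase θ) (hs : 0 < s) :
    HasDerivAt (conjPoint θ) ((amplitudeRatio θ s)⁻¹ ^ 2 * (s / conjPoint θ s)) s := by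
  have hT := h.conj_pos hs
  have h1 := h.hasDerivAt_invPhase hT
  rw [h.phase_conj hs] at h1
  refine (h1.comp s ((h.hasDerivAt s hs).add_const π)).congr_deriv ?_
  have hM := besselModulus_one_pos hs
  have hMT := besselModulus_one_pos hT
  unfold amplitudeRatio amplitude phaseDeriv
  field_simp

theorem besselJ_one_conj (h : IsPhase θ) (hs : 0 < s) : besselJ 1 (conjPoint θ s) =
    -(besselModulus 1 (conjPoint θ s) / besselModulus 1 s * besselJ 1 s) := by
  have hM := besselModulus_one_pos hs
  rw [h.cos_eq _ (h.conj_pos hs), h.phase_conj hs, Real.cos_add_pi, h.cos_eq s hs]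
  field_simp

theorem besselY_one_conj (h : IsPhase θ) (hs : 0 < s) : besselY 1 (conjPoint θ s) =
    -(besselModulus 1 (conjPoint θ s) / besselModulus 1 s * besselY 1 s) := by
  have hM := besselModulus_one_pos hs
  rw [h.sin_eq _ (h.conj_pos hs), h.phase_conj hs, Real.sin_add_pi, h.sin_eq s hs]
  field_simp

theorem amplitudeRatio_pos (h : IsPhase θ) (hs : 0 < s) : 0 < amplitudeRatio θ s :=
  div_pos (amplitude_pos hs) (amplitude_pos (h.conj_pos hs))

theorem cosSol_zero_conj (h : IsPhase θ) (hs : 0 < s) :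
    cosSol 0 s (conjPoint θ s) = -amplitudeRatio θ s := by
  have hT := h.conj_pos hs
  have hM := besselModulus_one_pos hs
  have hMT := besselModulus_one_pos hT
  have hW := bessel_wronskian hT
  rw [h.besselJ_one_conj hs, h.besselY_one_conj hs] at hW
  unfold cosSol cylinder amplitudeRatio amplitude
  have hπ := Real.pi_pos
  field_simp at hW ⊢
  linear_combination (-1) * hW

theorem cosSol_one_conj (h : IsPhase θ) (hs : 0 < s) : cosSol 1 s (conjPoint θ s) = 0 := by
  rw [h.cosSol_one_eq hs (h.conj_pos hs), h.phase_conj hs]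
  simp

theorem cosSol_one_pos (h : IsPhase θ) (hs : 0 < s) {q : ℝ} (hq : q ∈ Ioo s (conjPoint θ s)) :
    0 < cosSol 1 s q := by
  have hq0 := hs.trans hq.1
  rw [h.cosSol_one_eq hs hq0]
  have hM := besselModulus_one_pos hs
  have hMq := besselModulus_one_pos hq0
  have h1 := h.strictMonoOn hs hq0 hq.1
  have h2 := h.strictMonoOn hq0 (h.conj_pos hs) hq.2
  rw [h.phase_conj hs] at h2
  have := Real.sin_pos_of_pos_of_lt_pi (x := θ q - θ s) (by linarith) (by linarith)
  positivity

theorem cosSol_strictAntiOn (h : IsPhase θ) (hs : 0 < s) :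
    StrictAntiOn (cosSol 0 s) (Icc s (conjPoint θ s)) := by
  refine strictAntiOn_of_deriv_neg (convex_Icc _ _) (fun q hq =>
    (hasDerivAt_cosSol_zero s (hs.trans_le hq.1)).continuousAt.continuousWithinAt) fun q hq => ?_
  rw [interior_Icc] at hq
  rw [(hasDerivAt_cosSol_zero s (hs.trans hq.1)).deriv, Left.neg_neg_iff]
  exact h.cosSol_one_pos hs hq

/-- The energy `v² + v'²` is dissipated by the first-order term; at the two critical points it
equals `1` and `β²`. -/
theorem amplitudeRatio_le_one (h : IsPhase θ) (hs : 0 < s) : amplitudeRatio θ s ≤ 1 := by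
  have hd : ∀ q ∈ Icc s (conjPoint θ s), HasDerivAt (fun q => cosSol 0 s q ^ 2 + cosSol 1 s q ^ 2)
      (-(2 * cosSol 1 s q ^ 2 / q)) q := fun q hq => by
    have hq0 := hs.trans_le hq.1
    refine (((hasDerivAt_cosSol_zero s hq0).pow 2).add
      ((hasDerivAt_cosSol_one s hq0).pow 2)).congr_deriv ?_
    push_cast
    ring
  have hanti := antitoneOn_of_deriv_nonpos (convex_Icc s (conjPoint θ s))
    (fun q hq => (hd q hq).continuousAt.continuousWithinAt)
    (fun q hq => (hd q (interior_subset hq)).differentiableAt.differentiableWithinAt)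
    (fun q hq => by
      have hq0 := hs.trans_le (interior_subset hq).1
      rw [(hd q (interior_subset hq)).deriv, Left.neg_nonpos_iff]
      positivity)
  have hle := (h.lt_conj hs).le
  have := hanti (left_mem_Icc.2 hle) (right_mem_Icc.2 hle) hle
  simp only [cosSol_zero_self hs, cosSol_one_self, h.cosSol_zero_conj hs, h.cosSol_one_conj hs] at this
  have hb := h.amplitudeRatio_pos hs
  nlinarith

/-- Comparison of the zeros of `sinSol 0 s` (order zero) with those of `cosSol 1 s` (order one). -/
theorem sinSol_zero_conj_nonpos (h : IsPhase θ) (hs : 0 < s) : sinSol 0 s (conjPoint θ s) ≤ 0 := by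
  by_contra! hz
  have hle := (h.lt_conj hs).le
  have hb := h.amplitudeRatio_pos hs
  have hT := h.conj_pos hs
  -- By the Wronskian, `(z / v)' = s / (q v²) ≥ 0` away from the zero of `v`.
  have hratio : ∀ a b : ℝ, s ≤ a → a ≤ b → b ≤ conjPoint θ s → (∀ q ∈ Icc a b, cosSol 0 s q ≠ 0) →
      sinSol 0 s a / cosSol 0 s a ≤ sinSol 0 s b / cosSol 0 s b := by
    intro a b ha hab hbT hne
    have hd : ∀ q ∈ Icc a b, HasDerivAt (fun q => sinSol 0 s q / cosSol 0 s q)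
        (s / (q * cosSol 0 s q ^ 2)) q := fun q hq => by
      have hq0 := hs.trans_le (ha.trans hq.1)
      refine ((hasDerivAt_sinSol_zero s hq0).div (hasDerivAt_cosSol_zero s hq0)
        (hne q hq)).congr_deriv ?_
      have hW := cosSol_sinSol_wronskian hs hq0
      have := hne q hq
      field_simp
      linarith
    refine monotoneOn_of_deriv_nonneg (convex_Icc a b)
      (fun q hq => (hd q hq).continuousAt.continuousWithinAt)
      (fun q hq => (hd q (interior_subset hq)).differentiableAt.differentiableWithinAt)
      (fun q hq => ?_) (left_mem_Icc.2 hab) (right_mem_Icc.2 hab) hab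
    have hq0 := hs.trans_le (ha.trans (interior_subset hq).1)
    rw [(hd q (interior_subset hq)).deriv]
    positivity
  have hanti := (h.cosSol_strictAntiOn hs).antitoneOn
  -- Where `v > 0` compare `z / v` with its value at `s`; where `v < 0` compare with its value at
  -- `T`, negative by the assumption `z(T) > 0`. At the zero of `v` the Wronskian alone gives the
  -- sign.
  have hpos : ∀ q ∈ Ioo s (conjPoint θ s), 0 ≤ sinSol 0 s q := by
    intro q hq
    have hqI := Ioo_subset_Icc_self hq
    have hq0 := hs.trans hq.1
    rcases lt_trichotomy (cosSol 0 s q) 0 with hv | hv | hv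
    · have h1 := hratio q (conjPoint θ s) hq.1.le hq.2.le le_rfl fun r hr =>
        ((hanti hqI ⟨hq.1.le.trans hr.1, hr.2⟩ hr.1).trans_lt hv).ne
      rw [h.cosSol_zero_conj hs] at h1
      have h2 : sinSol 0 s (conjPoint θ s) / -amplitudeRatio θ s < 0 :=
        div_neg_of_pos_of_neg hz (by linarith)
      by_contra! hneg
      have := div_pos_of_neg_of_neg hneg hv
      linarith
    · have hW := cosSol_sinSol_wronskian hs hq0
      rw [hv, mul_zero, sub_zero] at hW
      have hw := h.cosSol_one_pos hs hq
      by_contra! hneg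
      have := mul_neg_of_pos_of_neg hq0 (mul_neg_of_neg_of_pos hneg hw)
      linarith
    · have h1 := hratio s q le_rfl hq.1.le hq.2.le fun r hr =>
        (hv.trans_le (hanti ⟨hr.1, hr.2.trans hq.2.le⟩ hqI hr.2)).ne'
      rw [sinSol_zero_self, zero_div] at h1
      by_contra! hneg
      have := div_neg_of_neg_of_pos hneg hv
      linarith
  -- With `w = -v'`, this function is `q (z' w - z w')`, the Wronskian of a solution of order zero
  -- with one of order one; the extra term of the order-one equation leaves `-z w / q`. It vanishes
  -- at `s` and cannot increase, yet at `T` it equals `T z(T) β > 0`.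
  have hd : ∀ q ∈ Icc s (conjPoint θ s), HasDerivAt (fun q => sinSol 0 s q * cosSol 1 s q -
      q * (sinSol 1 s q * cosSol 1 s q + sinSol 0 s q * cosSol 0 s q))
      (-(sinSol 0 s q * cosSol 1 s q / q)) q := fun q hq => by
    have hq0 := hs.trans_le hq.1
    have hz0 := hasDerivAt_sinSol_zero s hq0
    have hz1 := hasDerivAt_sinSol_one s hq0
    have hv0 := hasDerivAt_cosSol_zero s hq0
    have hv1 := hasDerivAt_cosSol_one s hq0
    refine ((hz0.mul hv1).sub ((hasDerivAt_id q).mul ((hz1.mul hv1).add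
      (hz0.mul hv0)))).congr_deriv ?_
    simp only [id, Pi.add_apply, Pi.mul_apply]
    field_simp
    ring
  have hanti2 := antitoneOn_of_deriv_nonpos (convex_Icc s (conjPoint θ s))
    (fun q hq => (hd q hq).continuousAt.continuousWithinAt)
    (fun q hq => (hd q (interior_subset hq)).differentiableAt.differentiableWithinAt)
    (fun q hq => by
      rw [(hd q (interior_subset hq)).deriv, Left.neg_nonpos_iff]
      rw [interior_Icc] at hq
      exact div_nonneg (mul_nonneg (hpos q hq) (h.cosSol_one_pos hs hq).le) (hs.trans hq.1).le)
  have := hanti2 (left_mem_Icc.2 hle) (right_mem_Icc.2 hle) hle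
  simp only [sinSol_zero_self, cosSol_one_self, h.cosSol_zero_conj hs, h.cosSol_one_conj hs] at this
  have := mul_pos hT (mul_pos hz hb)
  linarith

/-- Conceptually, `∂v_s / ∂s` is the solution `z`, since `v_s'' = -1` at `s`, and moving `T` costs
nothing because `T` is critical; hence `-β = v_s(T)` has derivative `z(T)`. The proof verifies this
on the amplitudes with the Wronskians at `s` and `T`. -/
theorem hasDerivAt_amplitudeRatio (h : IsPhase θ) (hs : 0 < s) :
    HasDerivAt (amplitudeRatio θ) (-sinSol 0 s (conjPoint θ s)) s := by
  have hT := h.conj_pos hs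
  have hM := besselModulus_one_pos hs
  have hMT := besselModulus_one_pos hT
  refine ((hasDerivAt_amplitude hs).div ((hasDerivAt_amplitude hT).comp s (h.hasDerivAt_conj hs))
    (amplitude_pos hT).ne').congr_deriv ?_
  have key : s * (besselJ 0 s * besselJ 1 s + besselY 0 s * besselY 1 s) -
      conjPoint θ s * (besselJ 0 (conjPoint θ s) * besselJ 1 (conjPoint θ s) +
        besselY 0 (conjPoint θ s) * besselY 1 (conjPoint θ s)) =
      conjPoint θ s * besselModulus 1 s * besselModulus 1 (conjPoint θ s) * -sinSol 0 s (conjPoint θ s) := by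
    have hW := bessel_wronskian hT
    have hWs := bessel_wronskian hs
    have hMs := besselModulus_sq 1 s
    rw [h.besselJ_one_conj hs, h.besselY_one_conj hs] at hW ⊢
    unfold sinSol cylinder
    set T := conjPoint θ s
    set A := besselModulus 1 s
    set B := besselModulus 1 T
    have hπ := Real.pi_pos
    field_simp at hW hWs ⊢
    rw [hMs]
    linear_combination
      -(s * (besselJ 1 s * besselJ 0 s + besselY 1 s * besselY 0 s)) * hW -
        B * T * (besselJ 1 s * besselJ 0 T + besselY 0 T * besselY 1 s) * hWs
  simp only [Function.comp]
  set gs := besselJ 0 s * besselJ 1 s + besselY 0 s * besselY 1 s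
  set gT := besselJ 0 (conjPoint θ s) * besselJ 1 (conjPoint θ s) +
        besselY 0 (conjPoint θ s) * besselY 1 (conjPoint θ s)
  rw [show -sinSol 0 s (conjPoint θ s) = (s * gs - conjPoint θ s * gT) /
    (conjPoint θ s * besselModulus 1 s * besselModulus 1 (conjPoint θ s)) by rw [key]; field_simp]
  unfold amplitudeRatio amplitude
  field_simp

theorem amplitudeRatio_monotoneOn (h : IsPhase θ) : MonotoneOn (amplitudeRatio θ) (Ioi 0) := by
  refine monotoneOn_of_deriv_nonneg (convex_Ioi 0)
    (fun s hs => (h.hasDerivAt_amplitudeRatio hs).continuousAt.continuousWithinAt)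
    (fun s hs => (h.hasDerivAt_amplitudeRatio
      (interior_subset hs)).differentiableAt.differentiableWithinAt) fun s hs => ?_
  have hs0 : 0 < s := interior_subset hs
  rw [(h.hasDerivAt_amplitudeRatio hs0).deriv]
  linarith [h.sinSol_zero_conj_nonpos hs0]

theorem conj_sq_sub_sq_monotoneOn (h : IsPhase θ) :
    MonotoneOn (fun s => conjPoint θ s ^ 2 - s ^ 2) (Ioi 0) := by
  have hd : ∀ s ∈ Ioi (0 : ℝ), HasDerivAt (fun s => conjPoint θ s ^ 2 - s ^ 2)
      (2 * s * ((amplitudeRatio θ s)⁻¹ ^ 2 - 1)) s := fun s hs => by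
    have hT := h.conj_pos hs
    refine (((h.hasDerivAt_conj hs).pow 2).sub (hasDerivAt_pow 2 s)).congr_deriv ?_
    push_cast
    field_simp
  refine monotoneOn_of_deriv_nonneg (convex_Ioi 0)
    (fun s hs => (hd s hs).continuousAt.continuousWithinAt)
    (fun s hs => (hd s (interior_subset hs)).differentiableAt.differentiableWithinAt) fun s hs => ?_
  have hs0 : 0 < s := interior_subset hs
  rw [(hd s hs0).deriv]
  have h1 : 1 ≤ (amplitudeRatio θ s)⁻¹ :=
    (one_le_inv₀ (h.amplitudeRatio_pos hs0)).2 (h.amplitudeRatio_le_one hs0)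
  have h2 : 0 ≤ (amplitudeRatio θ s)⁻¹ ^ 2 - 1 := by nlinarith
  positivity

/-- In this form `effSq` is visibly increasing in `s²`, in `T² - s²` and in `β`. -/
theorem effSq_eq (h : IsPhase θ) (hs : 0 < s) : effSq θ s =
    s ^ 2 + (conjPoint θ s ^ 2 - s ^ 2) * (1 - 1 / (1 + amplitudeRatio θ s)) := by
  have := h.amplitudeRatio_pos hs
  unfold effSq
  field_simp
  ring

theorem conj_sq_sub_sq_pos (h : IsPhase θ) (hs : 0 < s) : 0 < conjPoint θ s ^ 2 - s ^ 2 := by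
  have := h.lt_conj hs
  nlinarith

theorem effSq_strictMonoOn (h : IsPhase θ) : StrictMonoOn (effSq θ) (Ioi 0) := fun s hs t ht hst => by
  rw [h.effSq_eq hs, h.effSq_eq ht]
  have h1 := h.conj_sq_sub_sq_monotoneOn hs ht hst.le
  have h2 := h.amplitudeRatio_monotoneOn hs ht hst.le
  have hb := h.amplitudeRatio_pos hs
  have hp := h.conj_sq_sub_sq_pos ht
  have h3 : 1 - 1 / (1 + amplitudeRatio θ s) ≤ 1 - 1 / (1 + amplitudeRatio θ t) := by gcongr
  have h4 : 0 ≤ 1 - 1 / (1 + amplitudeRatio θ s) := by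
    rw [sub_nonneg, div_le_one (by positivity)]
    linarith
  have h5 : s ^ 2 < t ^ 2 := by
    have : 0 < s := hs
    gcongr
  have h6 := mul_le_mul h1 h3 h4 hp.le
  simp only at h6
  linarith

theorem continuousOn_effSq (h : IsPhase θ) : ContinuousOn (effSq θ) (Ioi 0) := fun s hs => by
  have hb := h.amplitudeRatio_pos hs
  have h1 := (h.hasDerivAt_amplitudeRatio hs).continuousAt
  have h2 := (h.hasDerivAt_conj hs).continuousAt
  exact (((h1.mul (h2.pow 2)).add (continuousAt_id.pow 2)).div (continuousAt_const.add h1)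
    (add_pos one_pos hb).ne').continuousWithinAt

theorem sq_lt_effSq (h : IsPhase θ) (hs : 0 < s) : s ^ 2 < effSq θ s := by
  rw [h.effSq_eq hs]
  have hb := h.amplitudeRatio_pos hs
  have h4 : 0 < 1 - 1 / (1 + amplitudeRatio θ s) := by
    rw [sub_pos, div_lt_one (by positivity)]
    linarith
  have := mul_pos (h.conj_sq_sub_sq_pos hs) h4
  linarith

theorem effSq_lt_conj_sq (h : IsPhase θ) (hs : 0 < s) : effSq θ s < conjPoint θ s ^ 2 := by
  rw [h.effSq_eq hs]
  have hb := h.amplitudeRatio_pos hs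
  have h4 : 0 < 1 / (1 + amplitudeRatio θ s) := by positivity
  have := mul_pos (h.conj_sq_sub_sq_pos hs) h4
  linarith

theorem tendsto_conj_zero (h : IsPhase θ) {q : ℝ} (hq : 0 < q) (hθ : θ q = π / 2) :
    Tendsto (conjPoint θ) (𝓝[>] 0) (𝓝 q) := by
  have h1 := (h.hasDerivAt_invPhase hq).continuousAt.tendsto
  rw [h.invPhase_phase hq, hθ] at h1
  have h2 := h.tendsto_zero.add_const π
  rw [show -(π / 2) + π = π / 2 by ring] at h2
  exact h1.comp h2

/-- No limit of `β` at `0` is needed: `β(s) ≤ β(1)` for `s ≤ 1` keeps the weight of `T²` below a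
fixed `κ < 1`, while `T² → q²` and `s² → 0`. -/
theorem exists_effSq_lt (h : IsPhase θ) {q : ℝ} (hq : 0 < q) (hθ : θ q = π / 2) :
    ∃ s, 0 < s ∧ effSq θ s < q ^ 2 := by
  have hb1 := h.amplitudeRatio_pos one_pos
  set κ := 1 - 1 / (1 + amplitudeRatio θ 1) with hκ
  have hκ0 : 0 < 1 / (1 + amplitudeRatio θ 1) := by positivity
  have hlim := (tendsto_id_nhdsGT_zero.pow 2).add
    (((h.tendsto_conj_zero hq hθ).pow 2).sub (tendsto_id_nhdsGT_zero.pow 2) |>.mul_const κ)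
  have hlt : (0 : ℝ) ^ 2 + (q ^ 2 - 0 ^ 2) * κ < q ^ 2 := by
    have := mul_pos (pow_pos hq 2) hκ0
    rw [hκ]
    linarith
  obtain ⟨s, hs1, hs⟩ := ((hlim.eventually (gt_mem_nhds hlt)).and
    (Ioc_mem_nhdsGT (zero_lt_one' ℝ))).exists
  refine ⟨s, hs.1, lt_of_le_of_lt ?_ hs1⟩
  rw [h.effSq_eq hs.1]
  have h2 := h.amplitudeRatio_monotoneOn hs.1 (mem_Ioi.2 one_pos) hs.2
  have hb := h.amplitudeRatio_pos hs.1
  have h3 : 1 - 1 / (1 + amplitudeRatio θ s) ≤ κ := by rw [hκ]; gcongr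
  have := mul_le_mul_of_nonneg_left h3 (h.conj_sq_sub_sq_pos hs.1).le
  linarith

theorem exists_effSq_eq (h : IsPhase θ) {q q₀ : ℝ} (hq : 0 < q) (hθ : θ q = π / 2) (hqq : q < q₀) :
    ∃ s, 0 < s ∧ effSq θ s = q₀ ^ 2 := by
  obtain ⟨a, ha, hlt⟩ := h.exists_effSq_lt hq hθ
  have hq₀ := hq.trans hqq
  have h1 : q ^ 2 < q₀ ^ 2 := by gcongr
  have h2 := h.sq_lt_effSq hq₀
  have hab : a ≤ q₀ := by
    by_contra! hlt2
    have := h.effSq_strictMonoOn hq₀ ha hlt2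
    linarith
  obtain ⟨s, hs, he⟩ := intermediate_value_Icc hab
    (h.continuousOn_effSq.mono fun y hy => ha.trans_le hy.1)
    ⟨(hlt.trans h1).le, h2.le⟩
  exact ⟨s, ha.trans_le hs.1, he⟩

/-- The first zero of `J₁` is the point with phase `π / 2`. -/
theorem isLeast_zero (h : IsPhase θ) {q : ℝ} (hq : 0 < q) (hθ : θ q = π / 2) :
    IsLeast {q : ℝ | 0 < q ∧ besselJ 1 q = 0} q := by
  refine ⟨⟨hq, by rw [h.cos_eq q hq, hθ, Real.cos_pi_div_two, mul_zero]⟩, fun x hx => ?_⟩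
  by_contra! hlt
  have h1 := h.strictMonoOn hx.1 hq hlt
  have h2 := h.neg_pi_div_two_lt hx.1
  have h3 := Real.cos_pos_of_mem_Ioo ⟨h2, hθ ▸ h1⟩
  have h4 := mul_pos (besselModulus_one_pos hx.1) h3
  rw [← h.cos_eq x hx.1, hx.2] at h4
  exact h4.false

/-- Every sufficiently large point is conjugate to a point at bounded distance. -/
theorem exists_conj_eq (h : IsPhase θ) :
    ∃ L : ℝ, 0 < L ∧ ∀ Q : ℝ, L ≤ Q → ∃ s, 0 < s ∧ conjPoint θ s = Q ∧ Q ≤ s + L := by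
  obtain ⟨L, hL, hadd⟩ := h.exists_add_pi_le
  have hT := h.conj_pos one_pos
  -- Adding `T(1)` ensures that the preimage `s` is at least `1`, where the bound on the half-turn
  -- length applies.
  refine ⟨L + conjPoint θ 1, by positivity, fun Q hQ => ?_⟩
  have hTQ : conjPoint θ 1 ≤ Q := by linarith
  have hQ0 := hT.trans_le hTQ
  have h1Q : 1 ≤ Q := (h.lt_conj one_pos).le.trans hTQ
  have hθQ := h.strictMonoOn.monotoneOn hT hQ0 hTQ
  rw [h.phase_conj one_pos] at hθQ
  obtain ⟨s, hs, hse⟩ := intermediate_value_Icc h1Q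
    (h.continuousOn.mono fun y hy => one_pos.trans_le hy.1)
    (show θ Q - π ∈ _ from ⟨by linarith, by linarith [Real.pi_pos]⟩)
  have hs0 := one_pos.trans_le hs.1
  refine ⟨s, hs0, (h.eq_conj hQ0 (by linarith)).symm, ?_⟩
  have h3 := hadd s hs.1
  rw [hse, sub_add_cancel] at h3
  have := (h.strictMonoOn.le_iff_le hQ0 (show (0 : ℝ) < s + L by positivity)).1 h3
  linarith

end IsPhase

/-! ### Solutions of the rescaled problem -/

theorem ContDiffOn.hasDerivAt_deriv_two {v : ℝ → ℝ} {a b q : ℝ} (hv : ContDiffOn ℝ 2 v (Ioo a b))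
    (hq : q ∈ Ioo a b) :
    HasDerivAt v (deriv v q) q ∧ HasDerivAt (deriv v) (deriv (deriv v) q) q := by
  have hn : Ioo a b ∈ 𝓝 q := isOpen_Ioo.mem_nhds hq
  have h2 := (contDiffOn_succ_iff_deriv_of_isOpen (n := 1) isOpen_Ioo).1
    (by simpa [one_add_one_eq_two] using hv)
  exact ⟨((h2.1 q hq).differentiableAt hn).hasDerivAt,
    ((h2.2.2.differentiableOn one_ne_zero q hq).differentiableAt hn).hasDerivAt⟩

/-- The coefficients are the weighted Wronskians of `v` with `Y₀` and `J₀`, which are constant along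
the equation; the Bessel Wronskian then recovers `v`. -/
theorem exists_eq_cylinder {v : ℝ → ℝ} {a b : ℝ} (ha : 0 < a)
    (hv : ContDiffOn ℝ 2 v (Ioo a b))
    (hode : ∀ q ∈ Ioo a b, q * deriv (deriv v) q + deriv v q + q * v q = 0) :
    ∃ α β : ℝ, ∀ q ∈ Ioo a b, v q = cylinder 0 α β q := by
  have hconst : ∀ f : ℝ → ℝ, (∀ q ∈ Ioo a b, HasDerivAt f 0 q) → ∃ c, ∀ q ∈ Ioo a b, f q = c :=
    fun f hf => isOpen_Ioo.exists_is_const_of_deriv_eq_zero isPreconnected_Ioo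
      (fun z hz => (hf z hz).differentiableAt.differentiableWithinAt)
      (fun z hz => (hf z hz).deriv)
  obtain ⟨α, hα⟩ := hconst (fun q => -(π / 2) * (v q * (q * besselY 1 q) + q * deriv v q * besselY 0 q))
    fun q hq => by
      have hq0 := ha.trans hq.1
      obtain ⟨h1, h2⟩ := hv.hasDerivAt_deriv_two hq
      refine (((h1.mul (hasDerivAt_mul_besselY_one hq0)).add
        (((hasDerivAt_id q).mul h2).mul (hasDerivAt_besselY_zero hq0))).const_mul _).congr_deriv ?_
      have := hode q hq
      simp only [id, Pi.mul_apply]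
      linear_combination (-(π / 2)) * besselY 0 q * this
  obtain ⟨β, hβ⟩ := hconst (fun q => π / 2 * (v q * (q * besselJ 1 q) + q * deriv v q * besselJ 0 q))
    fun q hq => by
      obtain ⟨h1, h2⟩ := hv.hasDerivAt_deriv_two hq
      refine (((h1.mul (hasDerivAt_mul_besselJ_one q)).add
        (((hasDerivAt_id q).mul h2).mul (hasDerivAt_besselJ_zero q))).const_mul _).congr_deriv ?_
      have := hode q hq
      simp only [id, Pi.mul_apply]
      linear_combination (π / 2) * besselJ 0 q * this
  refine ⟨α, β, fun q hq => ?_⟩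
  have hq0 := ha.trans hq.1
  have hW := bessel_wronskian hq0
  unfold cylinder
  rw [← hα q hq, ← hβ q hq]
  have hπ := Real.pi_pos
  field_simp at hW ⊢
  linear_combination -v q * hW

theorem contDiffOn_cylinder_zero (a b : ℝ) : ContDiffOn ℝ 2 (cylinder 0 a b) (Ioi 0) := by
  have hd0 : DifferentiableOn ℝ (cylinder 0 a b) (Ioi 0) := fun q hq =>
    (hasDerivAt_cylinder_zero a b hq).differentiableAt.differentiableWithinAt
  have hd1 : DifferentiableOn ℝ (cylinder 1 a b) (Ioi 0) := fun q hq =>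
    (hasDerivAt_cylinder_one a b hq).differentiableAt.differentiableWithinAt
  have h1 : ContDiffOn ℝ 1 (cylinder 1 a b) (Ioi 0) := by
    refine (contDiffOn_succ_iff_deriv_of_isOpen (n := 0) isOpen_Ioi).2 ⟨hd1, by simp, ?_⟩
    rw [contDiffOn_zero]
    refine ContinuousOn.congr (f := fun q => cylinder 0 a b q - cylinder 1 a b q / q) ?_
      fun q hq => (hasDerivAt_cylinder_one a b hq).deriv
    exact hd0.continuousOn.sub (hd1.continuousOn.div continuousOn_id fun q hq => (mem_Ioi.1 hq).ne')
  have h2 := (contDiffOn_succ_iff_deriv_of_isOpen (n := 1) (f := cylinder 0 a b) isOpen_Ioi).2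
    ⟨hd0, by simp, h1.neg.congr fun q hq => (hasDerivAt_cylinder_zero a b hq).deriv⟩
  simpa [one_add_one_eq_two] using h2

/-- A cylinder function of order zero with a critical point `s` is a multiple of `cosSol 0 s`. -/
theorem cylinder_eq_mul_cosSol {α β s : ℝ} (hs : 0 < s) (h0 : cylinder 1 α β s = 0) (n : ℕ)
    (q : ℝ) : cylinder n α β q = cylinder 0 α β s * cosSol n s q := by
  have hW := bessel_wronskian hs
  unfold cosSol
  unfold cylinder at h0 ⊢
  have hπ := Real.pi_pos
  field_simp at hW ⊢
  linear_combination (-(α * besselJ n q + β * besselY n q)) * hW -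
    π * s * (besselJ 0 s * besselY n q - besselY 0 s * besselJ n q) * h0

namespace IsBesselSolution

variable {q₀ s t lam : ℝ} {v : ℝ → ℝ}

theorem exists_eqOn_cylinder (hv : IsBesselSolution q₀ s t lam v) :
    ∃ α β : ℝ, EqOn v (cylinder 0 α β) (Icc s t) ∧ cylinder 1 α β s = 0 ∧
      cylinder 1 α β t = 0 := by
  have hst := hv.qm_lt_qp
  obtain ⟨α, β, hc⟩ := exists_eq_cylinder hv.qm_pos hv.contDiffOn hv.ode
  have hcont : ContinuousOn v (Icc s t) := by
    intro q hq
    rcases eq_or_lt_of_le hq.1 with rfl | h1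
    · exact hv.left_deriv.continuousWithinAt
    rcases eq_or_lt_of_le hq.2 with rfl | h2
    · exact hv.right_deriv.continuousWithinAt
    exact (hv.contDiffOn.hasDerivAt_deriv_two ⟨h1, h2⟩).1.continuousAt.continuousWithinAt
  have hd : ∀ q ∈ Icc s t, HasDerivWithinAt (cylinder 0 α β) (-cylinder 1 α β q) (Icc s t) q :=
    fun q hq => (hasDerivAt_cylinder_zero α β (hv.qm_pos.trans_le hq.1)).hasDerivWithinAt
  have heq : EqOn v (cylinder 0 α β) (Icc s t) :=
    EqOn.of_subset_closure (s := Ioo s t) hc hcont (fun q hq => (hd q hq).continuousWithinAt)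
      Ioo_subset_Icc_self (closure_Ioo hst.ne).ge
  have huniq := uniqueDiffOn_Icc hst
  refine ⟨α, β, heq, ?_, ?_⟩
  · have hm := left_mem_Icc.2 hst.le
    have := (huniq s hm).eq_deriv _ hv.left_deriv ((hd s hm).congr heq (heq hm))
    linarith
  · have hm := right_mem_Icc.2 hst.le
    have := (huniq t hm).eq_deriv _ hv.right_deriv ((hd t hm).congr heq (heq hm))
    linarith

/-- Monotonicity says that `(1 + λ) sin (θ q - θ s)` keeps one sign, and `t` is a zero of it. Also
`1 + λ ≠ 0`, since otherwise `v` would vanish identically although `v(t) = -2`. -/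
theorem eq_conj {θ : ℝ → ℝ} (h : IsPhase θ) (hv : IsBesselSolution q₀ s t lam v) :
    t = conjPoint θ s ∧ EqOn v (fun q => (1 + lam) * cosSol 0 s q) (Icc s t) := by
  obtain ⟨α, β, heq, hs1, ht1⟩ := hv.exists_eqOn_cylinder
  have hs := hv.qm_pos
  have hst := hv.qm_lt_qp
  have ht := hs.trans hst
  have hc : cylinder 0 α β s = 1 + lam := by
    rw [← heq (left_mem_Icc.2 hst.le), hv.left_value]
  have heq2 : EqOn v (fun q => (1 + lam) * cosSol 0 s q) (Icc s t) := fun q hq => by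
    rw [heq hq, cylinder_eq_mul_cosSol hs hs1, hc]
  refine ⟨?_, heq2⟩
  have hlam : 1 + lam ≠ 0 := fun h0 => by
    have h1 := heq2 (right_mem_Icc.2 hst.le)
    have h2 := hv.right_value
    simp only [h0, zero_mul] at h1
    linarith
  have hw : ∀ q ∈ Icc s t, 0 ≤ (1 + lam) * cosSol 1 s q := fun q hq => by
    have hq0 := hs.trans_le hq.1
    have hd := ((hasDerivAt_cosSol_zero s hq0).const_mul (1 + lam)).hasDerivWithinAt (s := Icc s t)
    have hnp : derivWithin (fun q => (1 + lam) * cosSol 0 s q) (Icc s t) q ≤ 0 :=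
      (hv.antitoneOn.congr heq2).derivWithin_nonpos
    rw [hd.derivWithin (uniqueDiffOn_Icc hst q hq)] at hnp
    linarith
  have hpos : ∀ q, 0 < q → 0 < π * s / 2 * (besselModulus 1 s * besselModulus 1 q) := fun q hq => by
    have hM := besselModulus_one_pos hs
    have hMq := besselModulus_one_pos hq
    positivity
  have hsin : ∀ q ∈ Icc s t, 0 ≤ (1 + lam) * Real.sin (θ q - θ s) := fun q hq => by
    have hq0 := hs.trans_le hq.1
    have h1 := hw q hq
    rw [h.cosSol_one_eq hs hq0] at h1
    refine nonneg_of_mul_nonneg_left (b := π * s / 2 * (besselModulus 1 s * besselModulus 1 q))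
      (le_of_le_of_eq h1 ?_) (hpos q hq0)
    ring
  have hsint : Real.sin (θ t - θ s) = 0 := by
    rw [cylinder_eq_mul_cosSol hs hs1, hc, h.cosSol_one_eq hs ht] at ht1
    have h1 := (mul_eq_zero.1 ht1).resolve_left hlam
    rw [← mul_assoc] at h1
    exact (mul_eq_zero.1 h1).resolve_left (hpos t ht).ne'
  have hθ := h.strictMonoOn hs ht hst
  have hmid : ∀ φ, 0 ≤ φ → φ ≤ θ t - θ s → 0 ≤ (1 + lam) * Real.sin φ := by
    intro φ h0 h1
    obtain ⟨q, hq, hqe⟩ := intermediate_value_Icc hst.le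
      (h.continuousOn.mono fun y hy => hs.trans_le hy.1)
      (show θ s + φ ∈ _ from ⟨by linarith, by linarith⟩)
    have := hsin q hq
    rwa [hqe, add_sub_cancel_left] at this
  refine h.eq_conj ht ?_
  have hπ := Real.pi_pos
  rcases lt_trichotomy (θ t - θ s) π with h1 | h1 | h1
  · have := Real.sin_pos_of_pos_of_lt_pi (by linarith) h1
    linarith
  · linarith
  · exfalso
    -- Past the first half-turn the next zero of the sine is at `2π`, so the range contains `π / 2`
    -- and `3π / 2`, where the sine has opposite signs.
    have h2 : 2 * π ≤ θ t - θ s := by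
      by_contra! hlt
      have h3 := Real.sin_pos_of_pos_of_lt_pi (x := θ t - θ s - π) (by linarith) (by linarith)
      rw [Real.sin_sub_pi, hsint] at h3
      linarith
    have h3 := hmid (π / 2) (by linarith) (by linarith)
    have h4 := hmid (π / 2 + π) (by linarith) (by linarith)
    rw [Real.sin_add_pi] at h4
    rw [Real.sin_pi_div_two] at h3 h4
    exact hlam (by linarith)

end IsBesselSolution

namespace IsPhase

variable {θ : ℝ → ℝ} {s q₀ : ℝ}

theorem effSq_eq_iff (h : IsPhase θ) (hs : 0 < s) :
    (1 - amplitudeRatio θ s) / (1 + amplitudeRatio θ s) =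
      (conjPoint θ s ^ 2 + s ^ 2 - 2 * q₀ ^ 2) / (conjPoint θ s ^ 2 - s ^ 2) ↔ effSq θ s = q₀ ^ 2 := by
  have hb := h.amplitudeRatio_pos hs
  have hp := h.conj_sq_sub_sq_pos hs
  unfold effSq
  rw [div_eq_div_iff (by positivity) hp.ne', div_eq_iff (by positivity)]
  constructor <;> intro h1 <;> linarith

theorem isBesselSolution (h : IsPhase θ) (hs : 0 < s) (he : effSq θ s = q₀ ^ 2) :
    IsBesselSolution q₀ s (conjPoint θ s) ((1 - amplitudeRatio θ s) / (1 + amplitudeRatio θ s))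
      (fun q => 2 / (1 + amplitudeRatio θ s) * cosSol 0 s q) := by
  have hb := h.amplitudeRatio_pos hs
  have hd : ∀ q, 0 < q → HasDerivAt (fun q => 2 / (1 + amplitudeRatio θ s) * cosSol 0 s q)
      (2 / (1 + amplitudeRatio θ s) * -cosSol 1 s q) q := fun q hq =>
    (hasDerivAt_cosSol_zero s hq).const_mul _
  refine ⟨hs, h.lt_conj hs, ?_, ?_, ?_, ?_, ?_, ?_, ?_, (h.effSq_eq_iff hs).2 he⟩
  · exact contDiffOn_const.mul
      ((contDiffOn_cylinder_zero _ _).mono fun q hq => hs.trans hq.1)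
  · intro q hq
    have hq0 := hs.trans hq.1
    have hd2 : HasDerivAt (deriv fun q => 2 / (1 + amplitudeRatio θ s) * cosSol 0 s q)
        (2 / (1 + amplitudeRatio θ s) * -(cosSol 0 s q - cosSol 1 s q / q)) q := by
      refine ((hasDerivAt_cosSol_one s hq0).neg.const_mul _).congr_of_eventuallyEq ?_
      filter_upwards [lt_mem_nhds hq0] with y hy
      exact (hd y hy).deriv
    rw [hd2.deriv, (hd q hq0).deriv]
    field_simp
    ring
  · rw [cosSol_zero_self hs]
    field_simp
    ring
  · rw [h.cosSol_zero_conj hs]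
    field_simp
    ring
  · have := hd s hs
    rw [cosSol_one_self, neg_zero, mul_zero] at this
    exact this.hasDerivWithinAt
  · have := hd _ (h.conj_pos hs)
    rw [h.cosSol_one_conj hs, neg_zero, mul_zero] at this
    exact this.hasDerivWithinAt
  · intro a ha b hb' hab
    exact mul_le_mul_of_nonneg_left ((h.cosSol_strictAntiOn hs).antitoneOn ha hb' hab)
      (by positivity)

theorem isBesselSolution_unique (h : IsPhase θ) {t lam : ℝ} {v : ℝ → ℝ}
    (hv : IsBesselSolution q₀ s t lam v) :
    t = conjPoint θ s ∧ lam = (1 - amplitudeRatio θ s) / (1 + amplitudeRatio θ s) ∧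
      effSq θ s = q₀ ^ 2 ∧
      EqOn v (fun q => 2 / (1 + amplitudeRatio θ s) * cosSol 0 s q) (Icc s t) := by
  obtain ⟨rfl, heq⟩ := hv.eq_conj h
  have hs := hv.qm_pos
  have hb := h.amplitudeRatio_pos hs
  have h1 := heq (right_mem_Icc.2 hv.qm_lt_qp.le)
  simp only [hv.right_value, h.cosSol_zero_conj hs] at h1
  have hlam : lam = (1 - amplitudeRatio θ s) / (1 + amplitudeRatio θ s) := by
    rw [eq_div_iff (by positivity)]
    linarith
  have hlam1 : 1 + lam = 2 / (1 + amplitudeRatio θ s) := by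
    rw [hlam]
    field_simp
    ring
  refine ⟨rfl, hlam, (h.effSq_eq_iff hs).1 (hlam ▸ hv.lam_eq), ?_⟩
  rw [← hlam1]
  exact heq

theorem effRadius_mem (h : IsPhase θ) (hs : 0 < s) (hq₀ : 0 < q₀) (he : effSq θ s = q₀ ^ 2) :
    s < q₀ ∧ q₀ < conjPoint θ s := by
  have h1 := h.sq_lt_effSq hs
  have h2 := h.effSq_lt_conj_sq hs
  rw [he] at h1 h2
  exact ⟨lt_of_pow_lt_pow_left₀ 2 hq₀.le h1, lt_of_pow_lt_pow_left₀ 2 (h.conj_pos hs).le h2⟩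

end IsPhase

/-! ### The radial problem -/

/-- Extending a function by constants beyond its critical points `a`, `b` keeps it differentiable. -/
theorem hasDerivAt_comp_clamp {f f' : ℝ → ℝ} {a b : ℝ} (hab : a ≤ b)
    (hf : ∀ x ∈ Icc a b, HasDerivAt f (f' x) x) (ha : f' a = 0) (hb : f' b = 0) (r : ℝ) :
    HasDerivAt (fun r => f (max a (min r b))) (f' (max a (min r b))) r := by
  have hmem : ∀ r, max a (min r b) ∈ Icc a b := fun r =>
    ⟨le_max_left _ _, max_le hab (min_le_right _ _)⟩
  by_cases hr : r ∈ Ioo a b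
  · have e : ∀ x ∈ Ioo a b, max a (min x b) = x := fun x hx => by
      rw [min_eq_left hx.2.le, max_eq_right hx.1.le]
    rw [e r hr]
    refine (hf r (Ioo_subset_Icc_self hr)).congr_of_eventuallyEq ?_
    filter_upwards [isOpen_Ioo.mem_nhds hr] with x hx
    rw [e x hx]
  · have h0 : f' (max a (min r b)) = 0 := by
      rw [mem_Ioo, not_and_or, not_lt, not_lt] at hr
      rcases hr with h | h
      · rw [min_eq_left (h.trans hab), max_eq_left h, ha]
      · rw [min_eq_right h, max_eq_right hab, hb]
    have hd := hf _ (hmem r)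
    rw [h0] at hd ⊢
    rw [hasDerivAt_iff_isLittleO] at hd ⊢
    simp only [smul_zero, sub_zero] at hd ⊢
    have hc : Continuous fun r => max a (min r b) := by fun_prop
    -- At a point clamped to a critical end, the increment of `f` is `o` of the increment of the
    -- clamp, and the clamp is 1-Lipschitz.
    refine (hd.comp_tendsto (hc.tendsto r)).trans_isBigO ?_
    refine Asymptotics.IsBigO.of_bound 1 (Eventually.of_forall fun x => ?_)
    simp only [Function.comp, Real.norm_eq_abs, one_mul]
    have h1 := abs_max_sub_max_le_max a (min x b) a (min r b)
    have h2 := abs_min_sub_min_le_max x b r b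
    simp only [sub_self, abs_zero] at h1 h2
    rw [max_eq_right (abs_nonneg (min x b - min r b))] at h1
    rw [max_eq_left (abs_nonneg (x - r))] at h2
    exact h1.trans h2

namespace IsAnnularProfile

variable {ε δ R0 rm rp lam : ℝ} {u : ℝ → ℝ}

theorem rp_lt (h : IsAnnularProfile ε δ R0 rm rp lam u) (hδ : 0 < δ) : rp < R0 := by
  have := h.rp_le
  linarith

theorem hasDerivAt_and_continuousAt_deriv (h : IsAnnularProfile ε δ R0 rm rp lam u) {r : ℝ}
    (hr : r ∈ Ioo 0 R0) : HasDerivAt u (deriv u r) r ∧ ContinuousAt (deriv u) r := by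
  have hn : Ioo 0 R0 ∈ 𝓝 r := isOpen_Ioo.mem_nhds hr
  have h1 := (contDiffOn_succ_iff_deriv_of_isOpen (n := 0) isOpen_Ioo).1
    (by simpa using h.contDiffOn_one)
  exact ⟨((h1.1 r hr).differentiableAt hn).hasDerivAt,
    (h1.2.2.continuousOn r hr).continuousAt hn⟩

theorem Icc_subset (h : IsAnnularProfile ε δ R0 rm rp lam u) (hδ : 0 < δ) :
    Icc rm rp ⊆ Ioo 0 R0 := fun _ hr =>
  ⟨h.rm_pos.trans_le hr.1, hr.2.trans_lt (h.rp_lt hδ)⟩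

/-- The mean mass condition. -/
theorem integral_eq_iff (h : IsAnnularProfile ε δ R0 rm rp lam u) (hδ : 0 < δ) (r0 : ℝ) :
    (∫ r in (0 : ℝ)..R0, u r * r) = (2 * r0 ^ 2 - R0 ^ 2) / 2 ↔
      lam = (rp ^ 2 + rm ^ 2 - 2 * r0 ^ 2) / (rp ^ 2 - rm ^ 2) := by
  have hrm := h.rm_pos
  have hlt := h.rm_lt_rp
  have hrp := h.rp_lt hδ
  have hsub := h.Icc_subset hδ
  have hu : ContinuousOn u (Icc rm rp) := fun r hr =>
    (h.hasDerivAt_and_continuousAt_deriv (hsub hr)).1.continuousAt.continuousWithinAt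
  have e1 : EqOn (fun r => r) (fun r => u r * r) (uIoo 0 rm) := fun r hr => by
    rw [uIoo_of_le hrm.le] at hr
    simp only [h.eq_one r (Ioo_subset_Icc_self hr), one_mul]
  have e3 : EqOn (fun r => -r) (fun r => u r * r) (uIoo rp R0) := fun r hr => by
    rw [uIoo_of_le hrp.le] at hr
    simp only [h.eq_neg_one r (Ioo_subset_Ico_self hr), neg_one_mul]
  have i1 : IntervalIntegrable (fun r => u r * r) MeasureTheory.volume 0 rm :=
    (continuous_id.intervalIntegrable _ _).congr_uIoo e1
  have i3 : IntervalIntegrable (fun r => u r * r) MeasureTheory.volume rp R0 :=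
    (continuous_neg.intervalIntegrable _ _).congr_uIoo e3
  have i2 : IntervalIntegrable (fun r => u r * r) MeasureTheory.volume rm rp :=
    ContinuousOn.intervalIntegrable_of_Icc hlt.le (hu.mul continuousOn_id)
  have i4 : IntervalIntegrable (fun r => lam * r) MeasureTheory.volume rm rp :=
    (continuous_const.mul continuous_id).intervalIntegrable _ _
  have I1 : ∫ r in (0 : ℝ)..rm, u r * r = rm ^ 2 / 2 := by
    rw [← intervalIntegral.integral_congr_uIoo e1, integral_id]
    ring
  have I3 : ∫ r in rp..R0, u r * r = -((R0 ^ 2 - rp ^ 2) / 2) := by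
    rw [← intervalIntegral.integral_congr_uIoo e3, intervalIntegral.integral_neg, integral_id]
  have I4 : ∫ r in rm..rp, lam * r = lam * ((rp ^ 2 - rm ^ 2) / 2) := by
    rw [intervalIntegral.integral_const_mul, integral_id]
  -- The equation times `r` has divergence form `r (u + λ) = -ε² (r u_r)'`, and the flux vanishes at
  -- both ends.
  have I2 : (∫ r in rm..rp, (u r * r + lam * r)) = 0 := by
    rw [intervalIntegral.integral_eq_sub_of_hasDerivAt_of_le (f := fun r => -ε ^ 2 * (r * deriv u r))
      hlt.le _ _ (i2.add i4)]
    · simp [h.left_deriv, h.right_deriv]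
    · exact continuousOn_const.mul (continuousOn_id.mul fun r hr =>
        (h.hasDerivAt_and_continuousAt_deriv (hsub hr)).2.continuousWithinAt)
    · intro r hr
      have hr0 := hrm.trans hr.1
      obtain ⟨h1, h2⟩ := h.contDiffOn_two.hasDerivAt_deriv_two hr
      refine (((hasDerivAt_id r).mul h2).const_mul (-ε ^ 2)).congr_deriv ?_
      have hode := h.ode r hr
      rw [← add_mul, hode]
      simp only [id]
      field_simp
      ring
  rw [intervalIntegral.integral_add i2 i4, I4] at I2
  rw [← intervalIntegral.integral_add_adjacent_intervals (i1.trans i2) i3,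
    ← intervalIntegral.integral_add_adjacent_intervals i1 i2, I1, I3]
  have hp : 0 < rp ^ 2 - rm ^ 2 := by nlinarith
  rw [eq_div_iff hp.ne']
  constructor <;> intro h' <;> linarith

end IsAnnularProfile

namespace IsAnnularSolution

variable {ε δ R0 r0 rm rp lam : ℝ} {u : ℝ → ℝ}

theorem isBesselSolution (h : IsAnnularSolution ε δ R0 r0 rm rp lam u) (hε : 0 < ε) (hδ : 0 < δ) :
    IsBesselSolution (r0 / ε) (rm / ε) (rp / ε) lam (fun q => u (ε * q) + lam) := by
  have hp := h.profile
  have hmaps : ∀ q ∈ Ioo (rm / ε) (rp / ε), ε * q ∈ Ioo rm rp := fun q hq =>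
    ⟨(div_lt_iff₀' hε).1 hq.1, (lt_div_iff₀' hε).1 hq.2⟩
  have hmaps2 : ∀ q ∈ Icc (rm / ε) (rp / ε), ε * q ∈ Icc rm rp := fun q hq =>
    ⟨(div_le_iff₀' hε).1 hq.1, (le_div_iff₀' hε).1 hq.2⟩
  have hrm : ε * (rm / ε) = rm := by field_simp
  have hrp : ε * (rp / ε) = rp := by field_simp
  have hlt := hp.rm_lt_rp
  have hR := hp.rp_lt hδ
  have hsub := hp.Icc_subset hδ
  have hd1 : deriv (fun q => u (ε * q) + lam) = fun q => ε * deriv u (ε * q) := by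
    funext q
    rw [deriv_add_const, deriv_comp_mul_left, smul_eq_mul]
  have hend : ∀ r ∈ Icc rm rp, deriv u r = 0 →
      HasDerivWithinAt (fun q => u (ε * q) + lam) 0 (Icc (rm / ε) (rp / ε)) (r / ε) := by
    intro r hr h0
    have h1 := (hp.hasDerivAt_and_continuousAt_deriv (hsub hr)).1
    rw [h0] at h1
    have h2 : HasDerivAt u 0 (ε * (r / ε)) := by rwa [mul_div_cancel₀ r hε.ne']
    have h3 := (h2.comp (r / ε) ((hasDerivAt_id (r / ε)).const_mul ε)).add_const lam
    rw [zero_mul] at h3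
    exact h3.hasDerivWithinAt
  refine ⟨div_pos hp.rm_pos hε, by gcongr, ?_, ?_, ?_, ?_,
    hend rm (left_mem_Icc.2 hlt.le) hp.left_deriv, hend rp (right_mem_Icc.2 hlt.le) hp.right_deriv,
    ?_, ?_⟩
  · exact (hp.contDiffOn_two.comp (contDiff_const.mul contDiff_id).contDiffOn hmaps).add
      contDiffOn_const
  · intro q hq
    have hd2 : deriv (fun q => ε * deriv u (ε * q)) q = ε * (ε * deriv (deriv u) (ε * q)) := by
      rw [deriv_const_mul_field, deriv_comp_mul_left, smul_eq_mul]
    have hq0 : 0 < q := (div_pos hp.rm_pos hε).trans hq.1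
    rw [hd1, hd2]
    simp only [hp.ode _ (hmaps q hq)]
    field_simp
    ring
  · simp only [hrm, hp.eq_one rm (right_mem_Icc.2 hp.rm_pos.le)]
  · simp only [hrp, hp.eq_neg_one rp (left_mem_Ico.2 hR)]
  · intro a ha b hb hab
    have h1 := hsub (hmaps2 a ha)
    have h2 := hsub (hmaps2 b hb)
    have := hp.antitoneOn (Ioo_subset_Ico_self h1) (Ioo_subset_Ico_self h2)
      (mul_le_mul_of_nonneg_left hab hε.le)
    simp only
    linarith
  · have hpq : 0 < rp ^ 2 - rm ^ 2 := by nlinarith [hp.rm_pos]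
    have e2 : (rp / ε) ^ 2 + (rm / ε) ^ 2 - 2 * (r0 / ε) ^ 2 =
        (rp ^ 2 + rm ^ 2 - 2 * r0 ^ 2) / ε ^ 2 := by ring
    have e3 : (rp / ε) ^ 2 - (rm / ε) ^ 2 = (rp ^ 2 - rm ^ 2) / ε ^ 2 := by ring
    rw [h.lam_eq, e2, e3, div_div_div_cancel_right₀ (by positivity)]

end IsAnnularSolution

/-- The radial profile obtained from the solution of the rescaled problem with `q₋ = s`. -/
def annularFun (θ : ℝ → ℝ) (ε s r : ℝ) : ℝ :=
  2 / (1 + amplitudeRatio θ s) * cosSol 0 s (max (ε * s) (min r (ε * conjPoint θ s)) / ε) -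
    (1 - amplitudeRatio θ s) / (1 + amplitudeRatio θ s)

theorem IsPhase.isAnnularSolution {θ : ℝ → ℝ} {s r0 ε δ R0 : ℝ} (h : IsPhase θ) (hs : 0 < s)
    (hε : 0 < ε) (hr0 : 0 < r0) (he : effSq θ s = (r0 / ε) ^ 2)
    (hle : ε * conjPoint θ s ≤ R0 - δ) :
    IsAnnularSolution ε δ R0 r0 (ε * s) (ε * conjPoint θ s)
      ((1 - amplitudeRatio θ s) / (1 + amplitudeRatio θ s)) (annularFun θ ε s) := by
  have hlt := h.lt_conj hs
  have hT := h.conj_pos hs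
  have hb := h.amplitudeRatio_pos hs
  have hv := h.isBesselSolution hs he
  obtain ⟨hm1, hm2⟩ := h.effRadius_mem hs (div_pos hr0 hε) he
  have hab : ε * s < ε * conjPoint θ s := by gcongr
  have ha0 : 0 < ε * s := by positivity
  set a := ε * s with ha
  set b := ε * conjPoint θ s with hbdef
  have has : a / ε = s := by rw [ha]; field_simp
  have hbT : b / ε = conjPoint θ s := by rw [hbdef]; field_simp
  set c := 2 / (1 + amplitudeRatio θ s) with hc
  have hc0 : 0 < c := by positivity
  set lam := (1 - amplitudeRatio θ s) / (1 + amplitudeRatio θ s) with hlam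
  set f : ℝ → ℝ := fun r => c * cosSol 0 s (r / ε) - lam with hf
  set f' : ℝ → ℝ := fun r => c * (-cosSol 1 s (r / ε) * (1 / ε)) with hf'
  have hfd : ∀ r, 0 < r → HasDerivAt f (f' r) r := fun r hr =>
    (((hasDerivAt_cosSol_zero s (div_pos hr hε)).comp r
      ((hasDerivAt_id r).div_const ε)).const_mul c).sub_const lam
  have hfd' : ∀ r, 0 < r → HasDerivAt f'
      (c * (-(cosSol 0 s (r / ε) - cosSol 1 s (r / ε) / (r / ε)) * (1 / ε) * (1 / ε))) r :=
    fun r hr => ((((hasDerivAt_cosSol_one s (div_pos hr hε)).comp r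
      ((hasDerivAt_id r).div_const ε)).neg.mul_const (1 / ε)).const_mul c).congr_deriv (by ring)
  have hfa : f a = 1 := by
    have := hv.left_value
    simp only [hf, has]
    linarith
  have hfb : f b = -1 := by
    have := hv.right_value
    simp only [hf, hbT]
    linarith
  have hfa' : f' a = 0 := by simp only [hf', has, cosSol_one_self]; ring
  have hfb' : f' b = 0 := by simp only [hf', hbT, h.cosSol_one_conj hs]; ring
  have hmaps : ∀ r ∈ Icc a b, r / ε ∈ Icc s (conjPoint θ s) := fun r hr => by
    rw [← hbT, ← has]
    exact ⟨div_le_div_of_nonneg_right hr.1 hε.le, div_le_div_of_nonneg_right hr.2 hε.le⟩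
  have hanti : StrictAntiOn f (Icc a b) := fun x hx y hy hxy => by
    have := h.cosSol_strictAntiOn hs (hmaps x hx) (hmaps y hy) (div_lt_div_of_pos_right hxy hε)
    have := mul_lt_mul_of_pos_left this hc0
    simp only [hf]
    linarith
  set k : ℝ → ℝ := fun r => max a (min r b) with hk
  have hu : annularFun θ ε s = fun r => f (k r) := rfl
  have hkmem : ∀ r, k r ∈ Icc a b := fun r => ⟨le_max_left _ _, max_le hab.le (min_le_right _ _)⟩
  have hkmid : ∀ r ∈ Icc a b, k r = r := fun r hr => by
    simp only [hk, min_eq_left hr.2, max_eq_right hr.1]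
  have hkleft : ∀ r, r ≤ a → k r = a := fun r hr => by
    simp only [hk, min_eq_left (hr.trans hab.le), max_eq_left hr]
  have hkright : ∀ r, b ≤ r → k r = b := fun r hr => by
    simp only [hk, min_eq_right hr, max_eq_right hab.le]
  have hkcont : Continuous k := by simp only [hk]; fun_prop
  have hud : ∀ r, HasDerivAt (annularFun θ ε s) (f' (k r)) r := fun r =>
    hasDerivAt_comp_clamp hab.le (fun x hx => hfd x (ha0.trans_le hx.1)) hfa' hfb' r
  have hderiv : deriv (annularFun θ ε s) = fun r => f' (k r) := funext fun r => (hud r).deriv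
  refine ⟨⟨ha0, hab, hle, fun r hr => ?_, fun r hr => ?_, fun r hr => ?_, ?_, ?_, ?_, fun r hr => ?_,
    ?_, ?_⟩, ?_, ?_, ?_⟩
  · simp only [hu, hkleft r hr.2, hfa]
  · have hrI := Ioo_subset_Icc_self hr
    have h1 := hanti (left_mem_Icc.2 hab.le) hrI hr.1
    have h2 := hanti hrI (right_mem_Icc.2 hab.le) hr.2
    rw [hfa] at h1
    rw [hfb] at h2
    simp only [hu, hkmid r hrI]
    exact ⟨h2, h1⟩
  · simp only [hu, hkright r hr.1, hfb]
  · intro x _ y _ hxy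
    exact hanti.antitoneOn (hkmem x) (hkmem y) (max_le_max_left _ (min_le_min_right _ hxy))
  · refine (contDiff_one_iff_deriv.2 ⟨fun r => (hud r).differentiableAt, ?_⟩).contDiffOn
    rw [hderiv]
    exact continuous_iff_continuousAt.2 fun r =>
      ((hfd' (k r) (ha0.trans_le (hkmem r).1)).continuousAt).comp hkcont.continuousAt
  · refine ContDiffOn.congr (f := f) ?_ fun r hr => by
      simp only [hu, hkmid r (Ioo_subset_Icc_self hr)]
    refine (contDiffOn_const.mul ((contDiffOn_cylinder_zero _ _).comp
      (contDiff_id.div_const ε).contDiffOn fun r hr => ?_)).sub contDiffOn_const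
    exact div_pos (ha0.trans hr.1) hε
  · have hrI := Ioo_subset_Icc_self hr
    have hr0' := ha0.trans hr.1
    have hd2 : deriv (fun r => f' (k r)) r =
        c * (-(cosSol 0 s (r / ε) - cosSol 1 s (r / ε) / (r / ε)) * (1 / ε) * (1 / ε)) := by
      refine ((hfd' r hr0').congr_of_eventuallyEq ?_).deriv
      filter_upwards [isOpen_Ioo.mem_nhds hr] with x hx
      rw [hkmid x (Ioo_subset_Icc_self hx)]
    rw [hderiv, hd2]
    simp only [hu, hkmid r hrI, hf, hf']
    field_simp
    ring
  · rw [hderiv]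
    simp only [hkleft a le_rfl, hfa']
  · rw [hderiv]
    simp only [hkright b le_rfl, hfb']
  · rw [ha]; exact (lt_div_iff₀' hε).1 hm1
  · rw [hbdef]; exact (div_lt_iff₀' hε).1 hm2
  · have e := hv.lam_eq
    rw [← hbT, ← has] at e
    have hpq : 0 < b ^ 2 - a ^ 2 := by nlinarith
    have e2 : (b / ε) ^ 2 + (a / ε) ^ 2 - 2 * (r0 / ε) ^ 2 =
        (b ^ 2 + a ^ 2 - 2 * r0 ^ 2) / ε ^ 2 := by ring
    have e3 : (b / ε) ^ 2 - (a / ε) ^ 2 = (b ^ 2 - a ^ 2) / ε ^ 2 := by ring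
    rw [e2, e3, div_div_div_cancel_right₀ (by positivity)] at e
    exact e

theorem IsPhase.isAnnularSolution_unique {θ : ℝ → ℝ} {r0 rm rp lam ε δ R0 : ℝ} {u : ℝ → ℝ}
    (h : IsPhase θ) (hε : 0 < ε) (hδ : 0 < δ) (hu : IsAnnularSolution ε δ R0 r0 rm rp lam u) :
    ∃ s, 0 < s ∧ rm = ε * s ∧ rp = ε * conjPoint θ s ∧
      lam = (1 - amplitudeRatio θ s) / (1 + amplitudeRatio θ s) ∧ effSq θ s = (r0 / ε) ^ 2 ∧
      EqOn u (annularFun θ ε s) (Ico 0 R0) := by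
  have hv := hu.isBesselSolution hε hδ
  obtain ⟨h1, h2, h3, h4⟩ := h.isBesselSolution_unique hv
  have hrm : rm = ε * (rm / ε) := by field_simp
  have hrp : rp = ε * conjPoint θ (rm / ε) := by rw [← h1]; field_simp
  have hlt := hu.profile.rm_lt_rp
  have hr0 := hu.profile.rm_pos.trans hu.rm_lt_r0
  refine ⟨rm / ε, hv.qm_pos, hrm, hrp, h2, h3, fun r hr => ?_⟩
  have hw := (h.isAnnularSolution hv.qm_pos hε hr0 h3
    (by rw [← hrp]; exact hu.profile.rp_le)).profile
  rw [← hrm, ← hrp, ← h2] at hw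
  rcases le_or_gt r rm with hr1 | hr1
  · rw [hu.profile.eq_one r ⟨hr.1, hr1⟩, hw.eq_one r ⟨hr.1, hr1⟩]
  rcases le_or_gt rp r with hr2 | hr2
  · rw [hu.profile.eq_neg_one r ⟨hr2, hr.2⟩, hw.eq_neg_one r ⟨hr2, hr.2⟩]
  have h5 := h4 (show r / ε ∈ Icc (rm / ε) (rp / ε) from
    ⟨div_le_div_of_nonneg_right hr1.le hε.le, div_le_div_of_nonneg_right hr2.le hε.le⟩)
  simp only [mul_div_cancel₀ r hε.ne'] at h5
  unfold annularFun
  rw [← hrm, ← hrp, ← h2, min_eq_left hr2.le, max_eq_right hr1.le]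
  linarith

end

/-! ### Assembly of the rescaled and radial statements -/

theorem theorem4 :
    ∃ qbar : ℝ,
      -- `qbar` is the first positive zero of `J_1`, and `qbar = θ_1⁻¹(π/2)`
      IsLeast {q : ℝ | 0 < q ∧ besselJ 1 q = 0} qbar ∧
      (∃ θ : ℝ → ℝ, IsBesselPhase 1 θ ∧ StrictMonoOn θ (Ioi 0) ∧ θ qbar = π / 2) ∧
      -- the rescaled problem
      (∀ q0 : ℝ, qbar < q0 →
        ∃ (qm qp lam : ℝ) (v : ℝ → ℝ),
          IsBesselSolution q0 qm qp lam v ∧ qm < q0 ∧ q0 < qp ∧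
          ∀ (qm' qp' lam' : ℝ) (v' : ℝ → ℝ), IsBesselSolution q0 qm' qp' lam' v' →
            qm' = qm ∧ qp' = qp ∧ lam' = lam ∧ EqOn v' v (Icc qm qp)) ∧
      -- in the radial problem, the relation for `lam` is the mean mass condition
      (∀ ε δ R0 r0 rm rp lam : ℝ, ∀ u : ℝ → ℝ, 0 < ε → 0 < δ →
        IsAnnularProfile ε δ R0 rm rp lam u →
          ((∫ r in (0 : ℝ)..R0, u r * r) = (2 * r0 ^ 2 - R0 ^ 2) / 2 ↔
            lam = (rp ^ 2 + rm ^ 2 - 2 * r0 ^ 2) / (rp ^ 2 - rm ^ 2))) ∧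
      -- the radial problem
      ∃ C : ℝ, 0 < C ∧ ∀ ε δ R0 : ℝ, 0 < ε → 0 < δ → C * ε ≤ R0 - δ →
        ∃ r0sup : ℝ, |r0sup - (R0 - δ)| ≤ C * ε ∧ ε * qbar < r0sup ∧
          (∀ r0 : ℝ, r0 ∈ Ioc (ε * qbar) r0sup →
            ∃ (rm rp lam : ℝ) (u : ℝ → ℝ),
              IsAnnularSolution ε δ R0 r0 rm rp lam u ∧
              (r0 = r0sup → rp = R0 - δ) ∧
              ∀ (rm' rp' lam' : ℝ) (u' : ℝ → ℝ), IsAnnularSolution ε δ R0 r0 rm' rp' lam' u' →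
                rm' = rm ∧ rp' = rp ∧ lam' = lam ∧ EqOn u' u (Ico 0 R0)) ∧
          (∀ r0 : ℝ, r0sup < r0 →
            ¬ ∃ (rm rp lam : ℝ) (u : ℝ → ℝ), IsAnnularSolution ε δ R0 r0 rm rp lam u) := by

  obtain ⟨θ, h⟩ := exists_isPhase
  obtain ⟨q, hq, hθ⟩ := h.exists_eq (φ := π / 2) (by linarith [Real.pi_pos])
  refine ⟨q, h.isLeast_zero hq hθ, ⟨θ, h.toIsBesselPhase, h.strictMonoOn, hθ⟩, ?_,
    fun ε δ R0 r0 rm rp lam u _ hδ hu => hu.integral_eq_iff hδ r0, ?_⟩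
  · intro q0 hq0
    obtain ⟨s, hs, he⟩ := h.exists_effSq_eq hq hθ hq0
    obtain ⟨h1, h2⟩ := h.effRadius_mem hs (hq.trans hq0) he
    refine ⟨s, _, _, _, h.isBesselSolution hs he, h1, h2, fun qm' qp' lam' v' hv => ?_⟩
    obtain ⟨e1, e2, e3, e4⟩ := h.isBesselSolution_unique hv
    obtain rfl : qm' = s := h.effSq_strictMonoOn.injOn hv.qm_pos hs (e3.trans he.symm)
    subst e1
    exact ⟨rfl, rfl, e2, e4⟩
  · obtain ⟨L, hL, hconj⟩ := h.exists_conj_eq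
    -- The summand `q` yields `t ≥ (R0 - δ) / ε - L ≥ q`, hence `q < ρ`; `L` alone would give the
    -- distance estimate.
    refine ⟨L + q, by positivity, fun ε δ R0 hε hδ hR => ?_⟩
    have hQ : L + q ≤ (R0 - δ) / ε := (le_div_iff₀ hε).2 hR
    -- This `t` is the extremal `q₋`, whose `q₊` touches the constraint; both its effective radius
    -- `ρ` and `(R0 - δ) / ε` lie in `[t, t + L]`.
    obtain ⟨t, ht, htQ, htL⟩ := hconj ((R0 - δ) / ε) (by linarith)
    have htR : ε * conjPoint θ t = R0 - δ := by rw [htQ]; field_simp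
    have hpos : 0 < effSq θ t := (pow_pos ht 2).trans (h.sq_lt_effSq ht)
    have hsq : effSq θ t = √(effSq θ t) ^ 2 := (Real.sq_sqrt hpos.le).symm
    obtain ⟨hm1, hm2⟩ := h.effRadius_mem ht (Real.sqrt_pos.2 hpos) hsq
    set ρ := √(effSq θ t)
    have hρ : 0 < ρ := Real.sqrt_pos.2 hpos
    refine ⟨ε * ρ, ?_, ?_, ?_, ?_⟩
    · rw [← htR, abs_le]
      rw [← htQ] at htL
      have h1 := mul_le_mul_of_nonneg_left htL hε.le
      have h2 := mul_lt_mul_of_pos_left hm1 hε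
      have h3 := mul_lt_mul_of_pos_left hm2 hε
      have h4 := mul_pos hq hε
      have h5 := mul_pos hL hε
      constructor <;> linarith
    · exact mul_lt_mul_of_pos_left (by linarith) hε
    · intro r0 hr0
      have hq0 : q < r0 / ε := (lt_div_iff₀' hε).2 hr0.1
      have hr0pos : 0 < r0 := (mul_pos hε hq).trans hr0.1
      obtain ⟨s, hs, he⟩ := h.exists_effSq_eq hq hθ hq0
      have hst : s ≤ t := by
        refine (h.effSq_strictMonoOn.le_iff_le hs ht).1 ?_
        rw [he, hsq]
        have : r0 / ε ≤ ρ := (div_le_iff₀' hε).2 hr0.2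
        have : 0 < r0 / ε := by positivity
        gcongr
      have hle : ε * conjPoint θ s ≤ R0 - δ := by
        rw [← htR]
        exact mul_le_mul_of_nonneg_left (h.conj_strictMonoOn.monotoneOn hs ht hst) hε.le
      refine ⟨_, _, _, _, h.isAnnularSolution hs hε hr0pos he hle, ?_, ?_⟩
      · intro hr
        have hρr : r0 / ε = ρ := by rw [hr]; field_simp
        rw [hρr, ← hsq] at he
        rw [h.effSq_strictMonoOn.injOn hs ht he, htR]
      · intro rm' rp' lam' u' hu
        obtain ⟨s', hs', e1, e2, e3, e4, e5⟩ := h.isAnnularSolution_unique hε hδ hu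
        obtain rfl : s' = s := h.effSq_strictMonoOn.injOn hs' hs (e4.trans he.symm)
        exact ⟨e1, e2, e3, e5⟩
    · rintro r0 hr0 ⟨rm, rp, lam, u, hu⟩
      obtain ⟨s, hs, e1, e2, e3, e4, e5⟩ := h.isAnnularSolution_unique hε hδ hu
      have h1 : ε * conjPoint θ s ≤ ε * conjPoint θ t := by
        rw [← e2, htR]
        exact hu.profile.rp_le
      have h2 := (h.conj_strictMonoOn.le_iff_le hs ht).1 (le_of_mul_le_mul_left h1 hε)
      have h3 := h.effSq_strictMonoOn.monotoneOn hs ht h2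
      have h4 : ρ < r0 / ε := (lt_div_iff₀' hε).2 hr0
      have h5 : ρ ^ 2 < (r0 / ε) ^ 2 := by gcongr
      rw [e4, hsq] at h3
      linarith
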